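/- For $0<\alpha<1$ and a positive integer $d$, let $N_\alpha(d)$ be the maximum number of lines through the origin in $\mathbb{R}^d$ such that any two of them form the angle $\cos^{-1}\alpha$ (this maximum exists and is finite). For $\lambda>0$, let the spectral radius order $k(\lambda)$ be the minimum possible number of vertices of a finite simple graph whose adjacency matrix has largest eigenvalue $\lambda$, with $k(\lambda)=\infty$ if no such graph exists. **Theorem.** Let $0<\alpha<1$, let $\lambda=(1-\alpha)/(2\alpha)$ and let $k=k(\lambda)$. (a) If $k<\infty$, then there is some $d_0(\alpha)$ such that $$N_\alpha(d)=\left\lfloor \frac{k}{k-1}(d-1)\right\rfloor\qquad\text{for all } d\ge d_0(\alpha).$$ (b) If $k=\infty$, then $N_\alpha(d)=d+o(d)$ as $d\to\infty$ (with $\alpha$ fixed). -/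

import Mathlib

/-- A line through the origin of `ℝ^d`: a one-dimensional linear subspace. -/
def IsLine {d : ℕ} (l : Submodule ℝ (EuclideanSpace ℝ (Fin d))) : Prop :=
  Module.finrank ℝ l = 1

/-- The lines `l` and `m` form the angle `θ`. The angle of two lines is the smaller one of the
two angles `φ`, `π - φ`, where `φ` is the angle between nonzero direction vectors. -/
def FormAngle {d : ℕ} (l m : Submodule ℝ (EuclideanSpace ℝ (Fin d))) (θ : ℝ) : Prop :=
  ∀ u ∈ l, ∀ v ∈ m, u ≠ 0 → v ≠ 0 →
    min (InnerProductGeometry.angle u v) (Real.pi - InnerProductGeometry.angle u v) = θ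

/-- The possible sizes of finite sets of lines through the origin of `ℝ^d` that pairwise form the
angle `arccos α`. -/
def equiangularSizes (α : ℝ) (d : ℕ) : Set ℕ :=
  {n | ∃ L : Finset (Submodule ℝ (EuclideanSpace ℝ (Fin d))),
    L.card = n ∧ (∀ l ∈ L, IsLine l) ∧
      ∀ l ∈ L, ∀ m ∈ L, l ≠ m → FormAngle l m (Real.arccos α)}

/-- `N_α(d)`: the maximum number of lines in `ℝ^d` with pairwise angle `arccos α`. -/
noncomputable def maxEquiangularLines (α : ℝ) (d : ℕ) : ℕ :=
  sSup (equiangularSizes α d)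

open Classical in
/-- `x` is the top eigenvalue of the graph `G`, that is, the largest (real) eigenvalue of its
adjacency matrix. -/
def IsTopEigenvalue {n : ℕ} (G : SimpleGraph (Fin n)) (x : ℝ) : Prop :=
  IsGreatest {μ : ℝ | Module.End.HasEigenvalue (Matrix.toLin' (G.adjMatrix ℝ)) μ} x

/-- The spectral radius order `k(x)`: the least number of vertices of a finite simple graph with
top eigenvalue `x`, and `⊤` if there is no such graph. -/
noncomputable def spectralRadiusOrder (x : ℝ) : ℕ∞ :=
  sInf {k : ℕ∞ | ∃ n : ℕ, k = (n : ℕ∞) ∧ ∃ G : SimpleGraph (Fin n), IsTopEigenvalue G x}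

/-! Pick a unit vector on each of the n lines and join two vectors when their inner product is -α.
The Gram matrix is 2α(λ - A + J/2), where A is the adjacency matrix and J the all-ones matrix. So
configurations in ℝ^d correspond to graphs for which λ - A + J/2 is positive semidefinite of rank at
most d, and n ≤ d + nullity. Everything depends on how large the nullity can be.

Vectors may be negated. Cliques are bounded, so by Ramsey a large configuration has a large
independent set X. Negating the vectors joined to more than half of X leaves a graph whose degrees
are bounded in terms of α (`exists_bounded_degree_switching`).

Suppose A ≤ λ as a quadratic form. Kernel vectors are then λ-eigenvectors with sum zero. By
Perron–Frobenius the eigenspace has at most one dimension per component with top eigenvalue λ, each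
such component has at least k vertices, and a nonzero nonnegative eigenvector has nonzero sum. So m
≥ 1 such components give nullity at most m - 1 and mk ≤ n (`finrank_gramKer_of_top_le`), which
yields n ≤ k(d - 1)/(k - 1). For k = ∞ there is no such component.

Otherwise some component exceeds λ. Semidefiniteness forbids two nonadjacent disjoint subgraphs of
which one exceeds λ and the other reaches it (`GramNonneg.not_separated`), so all λ-eigenvectors
live on that component. Their multiplicity is at most εn + C (`exists_finrank_component_le`): delete
a net of about εn/2 vertices and the boundedly many vertices whose surrounding ball exceeds λ. Every
remaining ball has lost walks, so its even powers fall below those of λ by a fixed factor, and high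
moments bound the multiplicity. Hence n ≤ (d + C)/(1 - ε), which is below k(d - 1)/(k - 1) for small
ε and large d, and gives d + o(d) as ε tends to 0.

The lower bound comes from disjoint copies of a k-vertex graph with top eigenvalue λ, plus isolated
vertices. -/

set_option linter.unusedSectionVars false

/-! ### Ramsey's theorem -/

open scoped Classical in
theorem exists_clique_or_indep (q t : ℕ) : ∃ R : ℕ, ∀ (V : Type) (G : SimpleGraph V) (S : Finset V),
    R ≤ S.card → (∃ C ⊆ S, C.card = q ∧ ∀ i ∈ C, ∀ j ∈ C, i ≠ j → G.Adj i j) ∨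
      (∃ I ⊆ S, I.card = t ∧ ∀ i ∈ I, ∀ j ∈ I, ¬ G.Adj i j) := by
  induction q generalizing t with
  | zero => exact ⟨0, fun V G S _ => Or.inl ⟨∅, by simp⟩⟩
  | succ q ihq =>
    induction t with
    | zero => exact ⟨0, fun V G S _ => Or.inr ⟨∅, by simp⟩⟩
    | succ t iht =>
      obtain ⟨R₁, h₁⟩ := ihq (t + 1)
      obtain ⟨R₂, h₂⟩ := iht
      -- Among R₁ + R₂ further vertices, `v` has R₁ neighbours or R₂ non-neighbours; it extends a
      -- clique in the former or an independent set in the latter.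
      refine ⟨R₁ + R₂ + 1, fun V G S hS => ?_⟩
      obtain ⟨v, hv⟩ : S.Nonempty := Finset.card_pos.1 (by omega)
      have hsplit := Finset.card_filter_add_card_filter_not (s := S.erase v) (fun u => G.Adj v u)
      rw [Finset.card_erase_of_mem hv] at hsplit
      rcases le_or_gt R₁ ((S.erase v).filter (fun u => G.Adj v u)).card with h | h
      · rcases h₁ V G _ h with ⟨C, hC, hcard, hadj⟩ | ⟨I, hI, hcard, hadj⟩
        · have hvC : ∀ u ∈ C, G.Adj v u := fun u hu => (Finset.mem_filter.1 (hC hu)).2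
          have hv' : v ∉ C := fun h => G.irrefl (hvC v h)
          refine Or.inl ⟨insert v C, ?_, by rw [Finset.card_insert_of_notMem hv', hcard], ?_⟩
          · intro u hu
            rcases Finset.mem_insert.1 hu with rfl | hu
            · exact hv
            · exact Finset.mem_of_mem_erase (Finset.mem_filter.1 (hC hu)).1
          · intro i hi j hj hij
            rcases Finset.mem_insert.1 hi with rfl | hi' <;> rcases Finset.mem_insert.1 hj with rfl | hj'
            · exact absurd rfl hij
            · exact hvC j hj'
            · exact (hvC i hi').symm
            · exact hadj i hi' j hj' hij
        · exact Or.inr ⟨I, fun u hu => Finset.mem_of_mem_erase (Finset.mem_filter.1 (hI hu)).1,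
            hcard, hadj⟩
      · rcases h₂ V G ((S.erase v).filter (fun u => ¬ G.Adj v u)) (by omega) with
          ⟨C, hC, hcard, hadj⟩ | ⟨I, hI, hcard, hadj⟩
        · exact Or.inl ⟨C, fun u hu => Finset.mem_of_mem_erase (Finset.mem_filter.1 (hC hu)).1,
            hcard, hadj⟩
        · have hvI : ∀ u ∈ I, ¬ G.Adj v u := fun u hu => (Finset.mem_filter.1 (hI hu)).2
          have hv' : v ∉ I := fun h =>
            Finset.notMem_erase v S (Finset.mem_filter.1 (hI h)).1
          refine Or.inr ⟨insert v I, ?_, by rw [Finset.card_insert_of_notMem hv', hcard], ?_⟩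
          · intro u hu
            rcases Finset.mem_insert.1 hu with rfl | hu
            · exact hv
            · exact Finset.mem_of_mem_erase (Finset.mem_filter.1 (hI hu)).1
          · intro i hi j hj
            rcases Finset.mem_insert.1 hi with rfl | hi' <;> rcases Finset.mem_insert.1 hj with rfl | hj'
            · exact G.irrefl
            · exact hvI j hj'
            · exact fun h => hvI i hi' h.symm
            · exact hadj i hi' j hj'

open scoped Classical in
/-- The real adjacency matrix of a graph. -/
noncomputable def adjM {V : Type} (G : SimpleGraph V) : Matrix V V ℝ :=
  fun i j => if G.Adj i j then 1 else 0

/-- The matrix `x - A + J / 2` of the graph `G` is positive semidefinite. -/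
def GramNonneg {V : Type} [Fintype V] (G : SimpleGraph V) (lam : ℝ) : Prop :=
  ∀ x : V → ℝ, 0 ≤ lam * (x ⬝ᵥ x) - x ⬝ᵥ (adjM G).mulVec x + (∑ i, x i) ^ 2 / 2

/-! ### Test vectors for λ - A + J/2 -/

section Forms

variable {V : Type} [Fintype V]

theorem adjM_symm (G : SimpleGraph V) (i j : V) : adjM G i j = adjM G j i := by
  classical
  exact if_congr (G.adj_comm i j) rfl rfl

theorem adjM_nonneg (G : SimpleGraph V) (i j : V) : 0 ≤ adjM G i j := by
  unfold adjM; split_ifs <;> norm_num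

theorem adjM_isSymm (G : SimpleGraph V) : (adjM G).IsSymm := by
  ext i j; exact adjM_symm G j i

/-- The adjacency form as a double sum. -/
theorem form_eq_sum (B : Matrix V V ℝ) (x y : V → ℝ) :
    x ⬝ᵥ B.mulVec y = ∑ i, ∑ j, x i * B i j * y j := by
  simp [dotProduct, Matrix.mulVec, Finset.mul_sum, mul_assoc]

theorem form_comm {B : Matrix V V ℝ} (hB : B.IsSymm) (x y : V → ℝ) :
    x ⬝ᵥ B.mulVec y = y ⬝ᵥ B.mulVec x := by
  rw [Matrix.dotProduct_mulVec, ← Matrix.mulVec_transpose, hB.eq, dotProduct_comm]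

open scoped Classical in
/-- The indicator vector of a finite set. -/
noncomputable def indVec (P : Finset V) : V → ℝ := fun i => if i ∈ P then 1 else 0

theorem indVec_dot (P : Finset V) (y : V → ℝ) : indVec P ⬝ᵥ y = ∑ i ∈ P, y i := by
  classical
  simp [indVec, dotProduct, Finset.sum_ite_mem]

theorem indVec_form (B : Matrix V V ℝ) (P Q : Finset V) :
    indVec P ⬝ᵥ B.mulVec (indVec Q) = ∑ i ∈ P, ∑ j ∈ Q, B i j := by
  classical
  rw [indVec_dot]
  refine Finset.sum_congr rfl fun i _ => ?_
  rw [Matrix.mulVec, dotProduct_comm, indVec_dot]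

theorem indVec_sum (P : Finset V) : ∑ i, indVec P i = P.card := by
  classical
  simp [indVec]

variable [DecidableEq V]

theorem indVec_dot_indVec (P Q : Finset V) : indVec P ⬝ᵥ indVec Q = ((P ∩ Q).card : ℝ) := by
  classical
  rw [indVec_dot]; simp only [indVec, Finset.sum_ite_mem]; simp; congr!

/-- Testing positivity on a star together with a far independent set. -/
theorem star_form_nonneg {G : SimpleGraph V} {lam : ℝ} (hM : GramNonneg G lam) (v : V)
    (P Q : Finset V) (hPQ : Disjoint P Q) (hvP : ∀ u ∈ P, G.Adj v u) (hvQ : ∀ u ∈ Q, ¬ G.Adj v u)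
    (hvQ' : v ∉ Q) (hQ : 0 < Q.card)
    (hind : ∀ i ∈ P ∪ Q, ∀ j ∈ P ∪ Q, ¬ G.Adj i j) (p : ℝ) :
    2 * P.card * p ≤ lam * (1 + P.card * p ^ 2 + (1 + P.card * p) ^ 2 / Q.card) := by
  have hvP' : v ∉ P := fun h => G.irrefl (hvP v h)
  have hb : (0 : ℝ) < Q.card := by exact_mod_cast hQ
  set a : ℝ := (P.card : ℝ)
  set b : ℝ := (Q.card : ℝ)
  -- The weights 1 on `v`, `p` on `P` and `-q` on `Q` sum to zero, which kills the J term.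
  set q : ℝ := (1 + a * p) / b with hq
  have h := hM (indVec {v} + p • indVec P - q • indVec Q)
  have z : ∀ X ⊆ P ∪ Q, ∀ Y ⊆ P ∪ Q, indVec X ⬝ᵥ (adjM G).mulVec (indVec Y) = 0 := by
    intro X hX Y hY
    rw [indVec_form]
    exact Finset.sum_eq_zero fun i hi => Finset.sum_eq_zero fun j hj => by
      simp [adjM, hind i (hX hi) j (hY hj)]
  have s1 : P ⊆ P ∪ Q := Finset.subset_union_left
  have s2 : Q ⊆ P ∪ Q := Finset.subset_union_right
  have e1 : indVec {v} ⬝ᵥ (adjM G).mulVec (indVec {v}) = 0 := by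
    rw [indVec_form]; simp [adjM]
  have e2 : indVec {v} ⬝ᵥ (adjM G).mulVec (indVec P) = a := by
    rw [indVec_form, Finset.sum_singleton, Finset.sum_congr rfl (g := fun _ => (1 : ℝ))]
    · simp [a]
    · intro j hj; simp [adjM, hvP j hj]
  have e3 : indVec {v} ⬝ᵥ (adjM G).mulVec (indVec Q) = 0 := by
    rw [indVec_form, Finset.sum_singleton]
    exact Finset.sum_eq_zero fun j hj => by simp [adjM, hvQ j hj]
  have e2' := (form_comm (adjM_isSymm G) (indVec P) (indVec {v})).trans e2
  have e3' := (form_comm (adjM_isSymm G) (indVec Q) (indVec {v})).trans e3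
  have d1 : indVec {v} ⬝ᵥ indVec {v} = (1 : ℝ) := by rw [indVec_dot_indVec]; simp
  have d2 : indVec P ⬝ᵥ indVec P = a := by rw [indVec_dot_indVec]; simp [a]
  have d3 : indVec Q ⬝ᵥ indVec Q = b := by rw [indVec_dot_indVec]; simp [b]
  have d4 : indVec {v} ⬝ᵥ indVec P = (0 : ℝ) := by rw [indVec_dot_indVec]; simp [hvP']
  have d5 : indVec {v} ⬝ᵥ indVec Q = (0 : ℝ) := by rw [indVec_dot_indVec]; simp [hvQ']
  have d6 : indVec P ⬝ᵥ indVec Q = (0 : ℝ) := by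
    rw [indVec_dot_indVec, Finset.disjoint_iff_inter_eq_empty.1 hPQ]; simp
  have d4' := (dotProduct_comm (indVec P) (indVec {v})).trans d4
  have d5' := (dotProduct_comm (indVec Q) (indVec {v})).trans d5
  have d6' := (dotProduct_comm (indVec Q) (indVec P)).trans d6
  have hs : ∑ i, (indVec {v} + p • indVec P - q • indVec Q) i = 0 := by
    simp only [Pi.add_apply, Pi.sub_apply, Pi.smul_apply, smul_eq_mul, Finset.sum_add_distrib,
      Finset.sum_sub_distrib, ← Finset.mul_sum, indVec_sum]
    rw [hq]
    have : (1 + a * p) / b * b = 1 + a * p := by field_simp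
    simp only [Finset.card_singleton]
    change ((1 : ℕ) : ℝ) + p * a - (1 + a * p) / b * b = 0
    rw [this]; push_cast; ring
  rw [hs] at h
  simp only [Matrix.mulVec_add, Matrix.mulVec_sub, Matrix.mulVec_smul, dotProduct_add,
    dotProduct_sub, add_dotProduct, sub_dotProduct, dotProduct_smul, smul_dotProduct, smul_eq_mul,
    e1, e2, e3, e2', e3', z P s1 P s1, z P s1 Q s2, z Q s2 P s1, z Q s2 Q s2,
    d1, d2, d3, d4, d5, d6, d4', d5', d6'] at h
  have hqb : q * (q * b) = (1 + a * p) ^ 2 / b := by rw [hq]; field_simp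
  have e : lam * (1 + a * p ^ 2 + (1 + a * p) ^ 2 / b) =
    lam * (1 + a * p ^ 2 + q * (q * b)) := by rw [hqb]
  rw [e]
  linarith

/-- On the indicator vector of `C` the form equals |C|(λ + 1 - |C|/2). -/
theorem card_clique_le {G : SimpleGraph V} {lam : ℝ} (hM : GramNonneg G lam)
    (C : Finset V) (hC : ∀ i ∈ C, ∀ j ∈ C, i ≠ j → G.Adj i j) :
    (C.card : ℝ) ≤ 2 * lam + 2 ∨ C.card = 0 := by
  rcases Nat.eq_zero_or_pos C.card with h0 | h0
  · exact Or.inr h0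
  left
  have h := hM (indVec C)
  rw [indVec_sum, indVec_dot_indVec, indVec_form, Finset.inter_self] at h
  have : ∀ i ∈ C, ∑ j ∈ C, adjM G i j = C.card - 1 := by
    intro i hi
    rw [← Finset.add_sum_erase C _ hi, Finset.sum_congr rfl (g := fun _ => (1 : ℝ))]
    · rw [Finset.sum_const, Finset.card_erase_of_mem hi]
      simp [adjM, Nat.cast_sub h0]
    · intro j hj
      simp [adjM, hC i hi j (Finset.mem_of_mem_erase hj) (Finset.ne_of_mem_erase hj).symm]
  rw [Finset.sum_congr rfl this, Finset.sum_const, nsmul_eq_mul] at h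
  have hb : (0 : ℝ) < C.card := by exact_mod_cast h0
  by_contra hcon
  push Not at hcon
  nlinarith

/-- A vertex with at most half of a nonempty independent set as neighbours has boundedly many. -/
theorem card_nbrs_indep_le {G : SimpleGraph V} {lam : ℝ} (hlam : 0 < lam) (hM : GramNonneg G lam)
    (v : V) (P Q : Finset V) (hPQ : Disjoint P Q) (hvP : ∀ u ∈ P, G.Adj v u)
    (hvQ : ∀ u ∈ Q, ¬ G.Adj v u) (hvQ' : v ∉ Q) (hQ : 0 < Q.card) (hle : P.card ≤ Q.card)
    (hind : ∀ i ∈ P ∪ Q, ∀ j ∈ P ∪ Q, ¬ G.Adj i j) :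
    (P.card : ℝ) ≤ 2 * lam * (2 * lam + 1) := by
  -- As |P| ≤ |Q|, balancing on `Q` costs at most as much as `P` itself, up to a constant. The
  -- weight p = 1/(2λ) makes the joint cost 2λ|P|p² = |P|p, half of the gain 2|P|p.
  have h := star_form_nonneg hM v P Q hPQ hvP hvQ hvQ' hQ hind (1 / (2 * lam))
  have hb : (1 : ℝ) ≤ Q.card := by exact_mod_cast hQ
  have hab : (P.card : ℝ) ≤ Q.card := by exact_mod_cast hle
  have ha : (0 : ℝ) ≤ P.card := by positivity
  set a : ℝ := (P.card : ℝ)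
  set b : ℝ := (Q.card : ℝ)
  set p : ℝ := 1 / (2 * lam) with hp
  have hp0 : 0 < p := by positivity
  have hlp : lam * p = 1 / 2 := by rw [hp]; field_simp
  have hquot : (1 + a * p) ^ 2 / b ≤ 1 + 2 * p + a * p ^ 2 := by
    rw [div_le_iff₀ (by linarith)]
    have := mul_nonneg (sub_nonneg.2 hab) hp0.le
    have := mul_nonneg (sub_nonneg.2 hab) (mul_nonneg ha (sq_nonneg p))
    nlinarith
  have h2 := mul_le_mul_of_nonneg_left hquot hlam.le
  have h3 : lam * (a * p ^ 2) = a * p / 2 := by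
    rw [show lam * (a * p ^ 2) = a * p * (lam * p) by ring, hlp]; ring
  have h4 : a * p ≤ 2 * lam + 1 := by nlinarith
  have h5 : a = a * p * (2 * lam) := by rw [hp]; field_simp
  rw [h5]; nlinarith

/-- An independent neighbourhood far from a large independent set is bounded. -/
theorem card_star_le {G : SimpleGraph V} {lam : ℝ} (hlam : 0 < lam) (hM : GramNonneg G lam)
    (v : V) (P Q : Finset V) (hPQ : Disjoint P Q) (hvP : ∀ u ∈ P, G.Adj v u)
    (hvQ : ∀ u ∈ Q, ¬ G.Adj v u) (hvQ' : v ∉ Q) (hQ : (1 + P.card / lam) ^ 2 ≤ (Q.card : ℝ))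
    (hind : ∀ i ∈ P ∪ Q, ∀ j ∈ P ∪ Q, ¬ G.Adj i j) :
    (P.card : ℝ) ≤ 2 * lam ^ 2 := by
  have hb0 : (0 : ℝ) < Q.card := lt_of_lt_of_le (by positivity) hQ
  -- The weight 1/λ is optimal for the star alone; `Q` is so large that balancing costs at most λ.
  have h := star_form_nonneg hM v P Q hPQ hvP hvQ hvQ' (by exact_mod_cast hb0) hind (1 / lam)
  set a : ℝ := (P.card : ℝ)
  set b : ℝ := (Q.card : ℝ)
  have h1 : (1 + a * (1 / lam)) ^ 2 / b ≤ 1 := by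
    rw [div_le_one hb0]; simpa [div_eq_mul_inv] using hQ
  have h2 : 2 * a * (1 / lam) ≤ lam * (1 + a * (1 / lam) ^ 2 + 1) :=
    h.trans (by gcongr)
  have h3 : lam * (1 + a * (1 / lam) ^ 2 + 1) = 2 * lam + a * (1 / lam) := by field_simp; ring
  rw [h3] at h2
  have h4 : a * (1 / lam) ≤ 2 * lam := by linarith
  have h5 : a = a * (1 / lam) * lam := by field_simp
  rw [h5]; nlinarith

end Forms

/-! ### Gram matrices and switching to bounded degree -/

section Vectors

variable {d : ℕ} {V : Type}

/-- Unit vectors with pairwise inner products `±α`. -/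
def EquiVecs (α : ℝ) (v : V → EuclideanSpace ℝ (Fin d)) : Prop :=
  (∀ i, inner ℝ (v i) (v i) = 1) ∧
    ∀ i j, i ≠ j → inner ℝ (v i) (v j) = α ∨ inner ℝ (v i) (v j) = -α

/-- The graph joining the vectors with negative inner product. -/
def negGraph (v : V → EuclideanSpace ℝ (Fin d)) : SimpleGraph V where
  Adj i j := i ≠ j ∧ inner ℝ (v i) (v j) < 0
  symm := ⟨fun i j h => ⟨h.1.symm, by rw [real_inner_comm]; exact h.2⟩⟩
  loopless := ⟨fun i h => h.1 rfl⟩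

open scoped Classical in
theorem EquiVecs.inner_eq {α : ℝ} (hα : 0 < α) {v : V → EuclideanSpace ℝ (Fin d)}
    (hv : EquiVecs α v) (i j : V) : inner ℝ (v i) (v j) =
      α - 2 * α * adjM (negGraph v) i j + if i = j then 1 - α else 0 := by
  by_cases hij : i = j
  · subst hij
    rw [hv.1]; simp [adjM]
  · rcases hv.2 i j hij with h | h
    · have : ¬ (negGraph v).Adj i j := fun h' => by have := h'.2; linarith
      simp [h, hij, adjM, this]
    · have : (negGraph v).Adj i j := ⟨hij, by linarith⟩
      simp only [h, hij, adjM, this, if_true, if_false]; ring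

variable [Fintype V]

theorem EquiVecs.inner_sum {α : ℝ} (hα : 0 < α) {v : V → EuclideanSpace ℝ (Fin d)}
    (hv : EquiVecs α v) (x : V → ℝ) (j : V) : inner ℝ (v j) (∑ i, x i • v i) =
      2 * α * ((1 - α) / (2 * α) * x j - (adjM (negGraph v)).mulVec x j + (∑ i, x i) / 2) := by
  classical
  simp only [_root_.inner_sum, inner_smul_right, hv.inner_eq hα]
  simp only [mul_add, mul_sub, Finset.sum_add_distrib, Finset.sum_sub_distrib, Matrix.mulVec,
    dotProduct, mul_ite, mul_zero, Finset.sum_ite_eq, Finset.mem_univ, if_true]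
  have h1 : 2 * α * ((1 - α) / (2 * α) * x j) = x j * (1 - α) := by field_simp
  have h2 : ∑ i, x i * (2 * α * adjM (negGraph v) j i) =
      2 * α * ∑ i, adjM (negGraph v) j i * x i := by
    rw [Finset.mul_sum]; exact Finset.sum_congr rfl fun i _ => by ring
  rw [h1, h2, ← Finset.sum_mul]; ring

theorem EquiVecs.norm_sq_sum {α : ℝ} (hα : 0 < α) {v : V → EuclideanSpace ℝ (Fin d)}
    (hv : EquiVecs α v) (x : V → ℝ) : inner ℝ (∑ i, x i • v i) (∑ i, x i • v i) =
      2 * α * ((1 - α) / (2 * α) * (x ⬝ᵥ x) - x ⬝ᵥ (adjM (negGraph v)).mulVec x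
        + (∑ i, x i) ^ 2 / 2) := by
  rw [sum_inner]
  simp only [inner_smul_left, hv.inner_sum hα]
  simp only [dotProduct, Finset.mul_sum, sq, Finset.sum_mul, conj_trivial]
  simp only [← Finset.sum_add_distrib, ← Finset.sum_sub_distrib, Finset.sum_div, Finset.mul_sum]
  refine Finset.sum_congr rfl fun i _ => ?_
  simp only [← Finset.sum_mul, ← Finset.sum_div]
  ring

theorem EquiVecs.gramNonneg {α : ℝ} (hα : 0 < α) {v : V → EuclideanSpace ℝ (Fin d)}
    (hv : EquiVecs α v) : GramNonneg (negGraph v) ((1 - α) / (2 * α)) := by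
  intro x
  have h := hv.norm_sq_sum hα x
  have h0 : 0 ≤ inner ℝ (∑ i, x i • v i) (∑ i, x i • v i) := real_inner_self_nonneg
  rw [h] at h0
  exact nonneg_of_mul_nonneg_right h0 (by linarith)

/-- The vectors can be switched so that no vertex has a negative inner product with more than half
of `X`, keeping the vectors of `X`. -/
theorem EquiVecs.exists_switch {α : ℝ} (hα : 0 < α) {v : V → EuclideanSpace ℝ (Fin d)}
    (hv : EquiVecs α v) (X : Finset V) : ∃ w : V → EuclideanSpace ℝ (Fin d), EquiVecs α w ∧
      (∀ i ∈ X, w i = v i) ∧ ∀ i ∉ X, ∃ P ⊆ X, 2 * P.card ≤ X.card ∧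
        ∀ j ∈ X, (negGraph w).Adj i j ↔ j ∈ P := by
  classical
  set P : V → Finset V := fun i => X.filter fun j => (negGraph v).Adj i j with hP
  -- Negating a vector outside `X` complements its neighbourhood within `X`, so this is done exactly
  -- when that neighbourhood is more than half of `X`.
  set w : V → EuclideanSpace ℝ (Fin d) := fun i =>
    if i ∉ X ∧ X.card < 2 * (P i).card then -v i else v i with hw
  have hsign : ∀ i, w i = v i ∨ w i = -v i := fun i => by
    simp only [hw]; split_ifs <;> simp
  have hX : ∀ i ∈ X, w i = v i := fun i hi => by simp [hw, hi]
  refine ⟨w, ⟨fun i => ?_, fun i j hij => ?_⟩, hX, fun i hi => ?_⟩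
  · rcases hsign i with h | h
    all_goals rw [h]; try rw [inner_neg_neg]
    all_goals exact hv.1 i
  · rcases hsign i with h | h <;> rcases hsign j with h' | h' <;>
      rcases hv.2 i j hij with h'' | h'' <;> simp [h, h', h'']
  · by_cases hc : X.card < 2 * (P i).card
    · refine ⟨X \ P i, Finset.sdiff_subset, ?_, fun j hj => ?_⟩
      · rw [Finset.card_sdiff_of_subset (Finset.filter_subset _ _)]
        have : (X.filter fun j => (negGraph v).Adj i j).card = (P i).card := rfl
        omega
      · have hij : i ≠ j := fun h => hi (h ▸ hj)
        have hwi : w i = -v i := by simp [hw, hi, hc]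
        have e : j ∈ X \ P i ↔ ¬ inner ℝ (v i) (v j) < 0 := by
          rw [hP, Finset.mem_sdiff, Finset.mem_filter]
          exact ⟨fun h h' => h.2 ⟨hj, hij, h'⟩, fun h => ⟨hj, fun h' => h h'.2.2⟩⟩
        have e' : (negGraph w).Adj i j ↔ -inner ℝ (v i) (v j) < 0 := by
          rw [← inner_neg_left, ← hwi, ← hX j hj]
          exact ⟨fun h => h.2, fun h => ⟨hij, h⟩⟩
        rw [e, e']
        rcases hv.2 i j hij with h | h <;> rw [h]
        · exact ⟨fun _ => by linarith, fun _ => by linarith⟩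
        · exact ⟨fun _ => by linarith, fun h' => absurd (by linarith) h'⟩
    · refine ⟨P i, Finset.filter_subset _ _, by omega, fun j hj => ?_⟩
      have hwi : w i = v i := by simp [hw, hc]
      rw [hP, Finset.mem_filter]
      have e' : (negGraph w).Adj i j ↔ (negGraph v).Adj i j := by
        change (i ≠ j ∧ inner ℝ (w i) (w j) < 0) ↔ (i ≠ j ∧ inner ℝ (v i) (v j) < 0)
        rw [hwi, hX j hj]
      rw [e']
      exact ⟨fun h => ⟨hj, h⟩, fun h => h.2⟩

/-- Equiangular vectors can be switched so that the negative graph has bounded degree. -/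
theorem exists_bounded_degree_switching (α : ℝ) (hα : 0 < α) (hα1 : α < 1) :
    ∃ D : ℕ, ∀ (d : ℕ) (V : Type) [Fintype V] (v : V → EuclideanSpace ℝ (Fin d)), EquiVecs α v →
      ∃ w : V → EuclideanSpace ℝ (Fin d), EquiVecs α w ∧
        ∀ i, ∀ S : Finset V, (∀ j ∈ S, (negGraph w).Adj i j) → S.card ≤ D := by
  classical
  set lam := (1 - α) / (2 * α) with hlam_def
  have hlam : 0 < lam := div_pos (by linarith) (by linarith)
  -- `q` and `s` exceed the clique and star bounds; `a₀` bounds the neighbours in `X` after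
  -- switching; `b₀` is the size of the far set needed against a star with `s` leaves. `t` is chosen
  -- so that `b₀` vertices of `X` survive the deletion of `Z` below.
  set q : ℕ := ⌊2 * lam + 2⌋₊ + 1 with hq
  set a₀ : ℕ := ⌊2 * lam * (2 * lam + 1)⌋₊ with ha₀
  set s : ℕ := ⌊2 * lam ^ 2⌋₊ + 1 with hs
  set b₀ : ℕ := ⌈(1 + s / lam) ^ 2⌉₊ with hb₀
  set t : ℕ := b₀ + (s + 1) * (a₀ + 1) + 1 with ht
  obtain ⟨R, hR⟩ := exists_clique_or_indep q t
  obtain ⟨D, hD⟩ := exists_clique_or_indep q s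
  refine ⟨max R D, fun d V _ v hv => ?_⟩
  have noclique : ∀ w : V → EuclideanSpace ℝ (Fin d), EquiVecs α w → ∀ C : Finset V,
      C.card = q → ¬ ∀ i ∈ C, ∀ j ∈ C, i ≠ j → (negGraph w).Adj i j := by
    intro w hw C hC hadj
    rcases card_clique_le (hw.gramNonneg hα) C hadj with h | h
    · have := Nat.lt_floor_add_one (2 * lam + 2)
      rw [hC, hq] at h; push_cast at h; linarith
    · omega
  by_cases hcard : Fintype.card V < R
  · exact ⟨v, hv, fun i S _ => (Finset.card_le_univ S).trans (by omega)⟩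
  rcases hR V (negGraph v) Finset.univ (by rw [Finset.card_univ]; omega) with
    ⟨C, -, hC, hadj⟩ | ⟨X, -, hXc, hX⟩
  · exact absurd hadj (noclique v hv C hC)
  obtain ⟨w, hw, hwX, hwP⟩ := hv.exists_switch hα X
  have hM := hw.gramNonneg hα
  have hX' : ∀ i ∈ X, ∀ j ∈ X, ¬ (negGraph w).Adj i j := fun i hi j hj h =>
    hX i hi j hj ⟨h.1, by have := h.2; rwa [hwX i hi, hwX j hj] at this⟩
  have hfew : ∀ i, (X.filter fun j => (negGraph w).Adj i j).card ≤ a₀ := by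
    intro i
    by_cases hi : i ∈ X
    · rw [Finset.filter_eq_empty_iff.2 fun j hj => hX' i hi j hj]; simp
    obtain ⟨P, hPX, hPc, hP⟩ := hwP i hi
    have hPe : (X.filter fun j => (negGraph w).Adj i j) = P := by
      ext j
      rw [Finset.mem_filter]
      exact ⟨fun h => (hP j h.1).1 h.2, fun h => ⟨hPX h, (hP j (hPX h)).2 h⟩⟩
    rw [hPe]
    have hcs : (X \ P).card = X.card - P.card := Finset.card_sdiff_of_subset hPX
    refine Nat.le_floor (card_nbrs_indep_le hlam hM i P (X \ P) Finset.disjoint_sdiff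
      (fun u hu => (hP u (hPX hu)).2 hu)
      (fun u hu h => (Finset.mem_sdiff.1 hu).2 ((hP u (Finset.mem_sdiff.1 hu).1).1 h))
      (fun h => hi (Finset.mem_sdiff.1 h).1) (by omega) (by omega) ?_)
    rw [Finset.union_sdiff_of_subset hPX]
    exact hX'
  refine ⟨w, hw, fun i S hS => ?_⟩
  by_contra hcon
  rcases hD V (negGraph w) S (by omega) with ⟨C, -, hC, hadj⟩ | ⟨Y, hYS, hYc, hY⟩
  · exact noclique w hw C hC hadj
  -- Removing the star and all its neighbours from `X` leaves an independent set with no edge to the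
  -- star, which serves as the balancing set.
  set bad : V → Finset V := fun j => insert j (X.filter fun u => (negGraph w).Adj j u) with hbad
  set Z : Finset V := (insert i Y).biUnion bad with hZ
  have hZc : Z.card ≤ (s + 1) * (a₀ + 1) := by
    refine (Finset.card_biUnion_le_card_mul _ _ (a₀ + 1) fun j _ => ?_).trans ?_
    · exact (Finset.card_insert_le _ _).trans (by have := hfew j; omega)
    · exact Nat.mul_le_mul_right _ ((Finset.card_insert_le _ _).trans (by omega))
  have hmem : ∀ u ∈ X \ Z, ∀ j ∈ insert i Y, u ≠ j ∧ ¬ (negGraph w).Adj j u := by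
    intro u hu j hj
    rw [Finset.mem_sdiff] at hu
    refine ⟨fun h => hu.2 (Finset.mem_biUnion.2 ⟨j, hj, by simp [hbad, h]⟩),
      fun h => hu.2 (Finset.mem_biUnion.2 ⟨j, hj, by simp [hbad, h, hu.1]⟩)⟩
  have hcd : X.card - Z.card ≤ (X \ Z).card := Finset.le_card_sdiff Z X
  have hbig : b₀ ≤ (X \ Z).card := by omega
  have := card_star_le hlam hM i Y (X \ Z)
    (Finset.disjoint_left.2 fun u hu hu' => (hmem u hu' u (by simp [hu])).1 rfl)
    (fun u hu => hS u (hYS hu)) (fun u hu => (hmem u hu i (by simp)).2)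
    (fun h => (hmem i h i (by simp)).1 rfl)
    (by rw [hYc]; exact (Nat.le_ceil _).trans (by exact_mod_cast hbig)) ?_
  · rw [hYc, hs] at this
    have h2 := Nat.lt_floor_add_one (2 * lam ^ 2)
    push_cast at this; linarith
  · intro a ha b hb
    rcases Finset.mem_union.1 ha with ha' | ha' <;> rcases Finset.mem_union.1 hb with hb' | hb'
    · exact hY a ha' b hb'
    · exact (hmem b hb' a (by simp [ha'])).2
    · exact fun h => (hmem a ha' b (by simp [hb'])).2 h.symm
    · exact hX' a (Finset.mem_sdiff.1 ha').1 b (Finset.mem_sdiff.1 hb').1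

end Vectors

/-! ### Operator norms and moments -/

section NormBounds

variable {V : Type} [Fintype V]

theorem dot_self_nonneg (x : V → ℝ) : 0 ≤ x ⬝ᵥ x :=
  Finset.sum_nonneg fun i _ => mul_self_nonneg (x i)

theorem abs_dot_abs (x : V → ℝ) : |x| ⬝ᵥ |x| = x ⬝ᵥ x :=
  Finset.sum_congr rfl fun i _ => abs_mul_abs_self (x i)

theorem form_le_form_abs {B : Matrix V V ℝ} (hB : ∀ i j, 0 ≤ B i j) (x : V → ℝ) :
    |x ⬝ᵥ B.mulVec x| ≤ |x| ⬝ᵥ B.mulVec |x| := by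
  rw [form_eq_sum, form_eq_sum]
  refine (Finset.abs_sum_le_sum_abs _ _).trans (Finset.sum_le_sum fun i _ => ?_)
  refine (Finset.abs_sum_le_sum_abs _ _).trans (Finset.sum_le_sum fun j _ => ?_)
  rw [abs_mul, abs_mul, abs_of_nonneg (hB i j)]
  rfl

/-- Polarization: with y = Bx, the number 4t⟨y, y⟩ is the difference of the forms at x + ty and x -
ty. Take t = 1/c. -/
theorem mulVec_dot_mulVec_le {B : Matrix V V ℝ} (hB : B.IsSymm) {c : ℝ} (hc : 0 ≤ c)
    (h : ∀ x : V → ℝ, |x ⬝ᵥ B.mulVec x| ≤ c * (x ⬝ᵥ x)) (x : V → ℝ) :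
    B.mulVec x ⬝ᵥ B.mulVec x ≤ c ^ 2 * (x ⬝ᵥ x) := by
  set y := B.mulVec x with hy
  have key : ∀ t : ℝ, 4 * t * (y ⬝ᵥ y) ≤ 2 * c * (x ⬝ᵥ x + t ^ 2 * (y ⬝ᵥ y)) := by
    intro t
    have h1 := (abs_le.1 (h (x + t • y))).2
    have h2 := (abs_le.1 (h (x - t • y))).1
    have h3 := form_comm hB x y
    have h4 : y ⬝ᵥ B.mulVec x = y ⬝ᵥ y := by rw [← hy]
    have h5 := dotProduct_comm x y
    simp only [Matrix.mulVec_add, Matrix.mulVec_sub, Matrix.mulVec_smul, dotProduct_add,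
      dotProduct_sub, add_dotProduct, sub_dotProduct, dotProduct_smul, smul_dotProduct,
      smul_eq_mul, h3, h4, h5] at h1 h2
    nlinarith
  rcases hc.eq_or_lt with rfl | hc
  · have := key 1; linarith
  · have h1 := key (1 / c)
    have h2 : 2 * c * (x ⬝ᵥ x + (1 / c) ^ 2 * (y ⬝ᵥ y)) =
      2 * c * (x ⬝ᵥ x) + 2 * (1 / c) * (y ⬝ᵥ y) := by field_simp
    have h3 : (1 / c) * (y ⬝ᵥ y) ≤ c * (x ⬝ᵥ x) := by linarith
    have h4 := mul_le_mul_of_nonneg_left h3 hc.le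
    have h5 : c * ((1 / c) * (y ⬝ᵥ y)) = y ⬝ᵥ y := by field_simp
    rw [h5] at h4; linarith

variable [DecidableEq V]

theorem isSymm_pow {B : Matrix V V ℝ} (hB : B.IsSymm) (n : ℕ) : (B ^ n).IsSymm := by
  unfold Matrix.IsSymm
  rw [Matrix.transpose_pow, hB.eq]

theorem pow_mulVec_dot_le {B : Matrix V V ℝ} (hB : B.IsSymm) {c : ℝ} (hc : 0 ≤ c)
    (h : ∀ x : V → ℝ, |x ⬝ᵥ B.mulVec x| ≤ c * (x ⬝ᵥ x)) (n : ℕ) (x : V → ℝ) :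
    (B ^ n).mulVec x ⬝ᵥ (B ^ n).mulVec x ≤ c ^ (2 * n) * (x ⬝ᵥ x) := by
  induction n with
  | zero => simp
  | succ n ih =>
    rw [pow_succ', ← Matrix.mulVec_mulVec]
    refine (mulVec_dot_mulVec_le hB hc h _).trans ?_
    calc _ ≤ c ^ 2 * (c ^ (2 * n) * (x ⬝ᵥ x)) := by gcongr
      _ = _ := by ring

theorem form_pow_two_mul {B : Matrix V V ℝ} (hB : B.IsSymm) (n : ℕ) (x : V → ℝ) :
    x ⬝ᵥ (B ^ (2 * n)).mulVec x = (B ^ n).mulVec x ⬝ᵥ (B ^ n).mulVec x := by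
  rw [two_mul, pow_add, ← Matrix.mulVec_mulVec, form_comm (isSymm_pow hB n) x]

theorem pow_nonneg_entries {B : Matrix V V ℝ} (hB : ∀ i j, 0 ≤ B i j) (n : ℕ) (i j : V) :
    0 ≤ (B ^ n) i j := by
  induction n generalizing j with
  | zero => simp only [pow_zero, Matrix.one_apply]; split_ifs <;> norm_num
  | succ n ih =>
    rw [pow_succ, Matrix.mul_apply]
    exact Finset.sum_nonneg fun k _ => mul_nonneg (ih k) (hB k j)

theorem pow_le_pow_entries {B B' : Matrix V V ℝ} (hB : ∀ i j, 0 ≤ B i j)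
    (hBB' : ∀ i j, B i j ≤ B' i j) (n : ℕ) (i j : V) : (B ^ n) i j ≤ (B' ^ n) i j := by
  induction n generalizing j with
  | zero => simp
  | succ n ih =>
    rw [pow_succ, pow_succ, Matrix.mul_apply, Matrix.mul_apply]
    exact Finset.sum_le_sum fun k _ => mul_le_mul (ih k) (hBB' k j) (hB k j)
      ((pow_nonneg_entries hB n i k).trans (ih k))

/-- The dimension of an eigenspace is controlled by moments. -/
theorem finrank_mul_pow_le {B : Matrix V V ℝ} (hB : B.IsSymm) (W : Submodule ℝ (V → ℝ)) (lam : ℝ)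
    (hW : ∀ x ∈ W, B.mulVec x = lam • x) (n : ℕ) :
    (Module.finrank ℝ W : ℝ) * lam ^ (2 * n) ≤
      ∑ v, (B ^ n).mulVec (Pi.single v 1) ⬝ᵥ (B ^ n).mulVec (Pi.single v 1) := by
  have hWn : ∀ x ∈ W, (B ^ n).mulVec x = lam ^ n • x := by
    intro x hx
    induction n with
    | zero => simp
    | succ n ih =>
      rw [pow_succ, ← Matrix.mulVec_mulVec, hW x hx, Matrix.mulVec_smul, ih, smul_smul, pow_succ']
  let e := (WithLp.linearEquiv 2 ℝ (V → ℝ)).symm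
  let W' : Submodule ℝ (EuclideanSpace ℝ V) := W.map e.toLinearMap
  have hfr : Module.finrank ℝ W' = Module.finrank ℝ W := LinearEquiv.finrank_map_eq e W
  let b := stdOrthonormalBasis ℝ W'
  let u : Fin (Module.finrank ℝ W') → EuclideanSpace ℝ V := fun i => (b i : EuclideanSpace ℝ V)
  have hu : Orthonormal ℝ u := b.orthonormal.comp_linearIsometry W'.subtypeₗᵢ
  have huW : ∀ i, WithLp.ofLp (u i) ∈ W := by
    intro i
    obtain ⟨x, hx, hxe⟩ := Submodule.mem_map.1 (b i).2
    have : WithLp.ofLp (u i) = x := by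
      change WithLp.ofLp (b i : EuclideanSpace ℝ V) = x
      rw [← hxe]; rfl
    rwa [this]
  have hcoord : ∀ i v, inner ℝ (u i) (WithLp.toLp 2 ((B ^ n).mulVec (Pi.single v 1))) =
      lam ^ n * (u i) v := by
    intro i v
    rw [EuclideanSpace.inner_eq_star_dotProduct]
    simp only [star_trivial]
    rw [dotProduct_comm, form_comm (isSymm_pow hB n), hWn _ (huW i)]
    simp
  -- Bessel's inequality for Bⁿe_v and the orthonormal basis `u` of `W`. Summed over `v`, each basis
  -- vector contributes λ^(2n).
  have hbess : ∀ v, ∑ i, (lam ^ n * (u i) v) ^ 2 ≤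
      (B ^ n).mulVec (Pi.single v 1) ⬝ᵥ (B ^ n).mulVec (Pi.single v 1) := by
    intro v
    have := hu.sum_inner_products_le (WithLp.toLp 2 ((B ^ n).mulVec (Pi.single v 1)))
      (s := Finset.univ)
    simp only [hcoord] at this
    rw [EuclideanSpace.norm_sq_eq] at this
    simp only [Real.norm_eq_abs, sq_abs] at this
    refine this.trans (le_of_eq (Finset.sum_congr rfl fun i _ => ?_))
    exact sq _
  refine le_trans (le_of_eq ?_) (Finset.sum_le_sum fun v _ => hbess v)
  rw [Finset.sum_comm]
  have : ∀ i, ∑ v, (lam ^ n * (u i) v) ^ 2 = lam ^ (2 * n) := by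
    intro i
    simp only [mul_pow, ← Finset.mul_sum]
    have h1 := hu.1 i
    have h2 := EuclideanSpace.norm_sq_eq (u i)
    simp only [Real.norm_eq_abs, sq_abs] at h2
    rw [← h2, h1]; ring
  rw [Finset.sum_congr rfl fun i _ => this i]
  simp [hfr]

end NormBounds

/-! ### Balls and nets in graphs -/

section Balls

variable {V : Type} [Fintype V] [DecidableEq V]

open scoped Classical in
/-- The vertices reached from `v` by a walk of length at most `n`. -/
noncomputable def wball (G : SimpleGraph V) (n : ℕ) (v : V) : Finset V :=
  Finset.univ.filter fun u => ∃ p : G.Walk v u, p.length ≤ n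

theorem mem_wball {G : SimpleGraph V} {n : ℕ} {v u : V} :
    u ∈ wball G n v ↔ ∃ p : G.Walk v u, p.length ≤ n := by
  simp [wball]

theorem self_mem_wball (G : SimpleGraph V) (n : ℕ) (v : V) : v ∈ wball G n v :=
  mem_wball.2 ⟨.nil, by simp⟩

theorem wball_comm {G : SimpleGraph V} {n : ℕ} {v u : V} : u ∈ wball G n v ↔ v ∈ wball G n u := by
  rw [mem_wball, mem_wball]
  exact ⟨fun ⟨p, hp⟩ => ⟨p.reverse, by simpa using hp⟩,
    fun ⟨p, hp⟩ => ⟨p.reverse, by simpa using hp⟩⟩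

theorem wball_trans {G : SimpleGraph V} {m n : ℕ} {v u w : V} (h : u ∈ wball G m v)
    (h' : w ∈ wball G n u) : w ∈ wball G (m + n) v := by
  rw [mem_wball] at *
  obtain ⟨p, hp⟩ := h
  obtain ⟨q, hq⟩ := h'
  exact ⟨p.append q, by rw [SimpleGraph.Walk.length_append]; omega⟩

theorem wball_mono {G : SimpleGraph V} {m n : ℕ} (hmn : m ≤ n) {v u : V} (h : u ∈ wball G m v) :
    u ∈ wball G n v := by
  obtain ⟨p, hp⟩ := mem_wball.1 h
  exact mem_wball.2 ⟨p, hp.trans hmn⟩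

theorem wball_one_of_adj {G : SimpleGraph V} {v u : V} (h : G.Adj v u) : u ∈ wball G 1 v :=
  mem_wball.2 ⟨h.toWalk, by simp⟩

theorem mem_wball_of_mem_support {G : SimpleGraph V} {n : ℕ} {v u w : V} (p : G.Walk v u)
    (hp : p.length ≤ n) (hw : w ∈ p.support) : w ∈ wball G n v :=
  mem_wball.2 ⟨p.takeUntil w hw, (p.length_takeUntil_le_length hw).trans hp⟩

theorem card_wball_le {G : SimpleGraph V} {D : ℕ}
    (hD : ∀ i, ∀ S : Finset V, (∀ j ∈ S, G.Adj i j) → S.card ≤ D) (n : ℕ) (v : V) :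
    (wball G n v).card ≤ (D + 1) ^ n := by
  classical
  induction n generalizing v with
  | zero =>
    rw [pow_zero, Finset.card_le_one]
    have : ∀ a ∈ wball G 0 v, a = v := by
      intro a ha
      obtain ⟨p, hp⟩ := mem_wball.1 ha
      exact (SimpleGraph.Walk.eq_of_length_eq_zero (p := p) (by omega)).symm
    intro a ha b hb
    rw [this a ha, this b hb]
  | succ n ih =>
    have hsub : wball G (n + 1) v ⊆
        (insert v (Finset.univ.filter fun u => G.Adj v u)).biUnion (wball G n) := by
      intro u hu
      obtain ⟨p, hp⟩ := mem_wball.1 hu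
      rw [Finset.mem_biUnion]
      cases p with
      | nil => exact ⟨v, by simp, self_mem_wball G n v⟩
      | cons h q =>
        rename_i w
        rw [SimpleGraph.Walk.length_cons] at hp
        exact ⟨w, by simp [h], mem_wball.2 ⟨q, by omega⟩⟩
    refine (Finset.card_le_card hsub).trans
      ((Finset.card_biUnion_le_card_mul _ _ _ fun u _ => ih u).trans ?_)
    rw [pow_succ']
    exact Nat.mul_le_mul_right _ ((Finset.card_insert_le _ _).trans
      (Nat.succ_le_succ (hD v _ fun j hj => (Finset.mem_filter.1 hj).2)))

/-- A path to a vertex outside the ball is longer than `h`, and its first h + 1 vertices are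
distinct and lie in the ball. -/
theorem succ_le_card_wball {G : SimpleGraph V} {h : ℕ} {v z : V} (hvz : G.Reachable v z)
    (hz : z ∉ wball G h v) : h + 1 ≤ (wball G h v).card := by
  classical
  obtain ⟨p, hp⟩ := hvz.exists_isPath
  have hlen : h < p.length := by
    by_contra hcon
    exact hz (mem_wball.2 ⟨p, by omega⟩)
  have hsub : (Finset.range (h + 1)).image p.getVert ⊆ wball G h v := by
    intro u hu
    obtain ⟨i, hi, rfl⟩ := Finset.mem_image.1 hu
    refine mem_wball.2 ⟨p.take i, ?_⟩
    rw [SimpleGraph.Walk.take_length]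
    have := Finset.mem_range.1 hi
    omega
  calc h + 1 = (Finset.range (h + 1)).card := by simp
    _ = ((Finset.range (h + 1)).image p.getVert).card := by
      refine (Finset.card_image_of_injOn ?_).symm
      intro i hi j hj hij
      have hi' := Finset.mem_range.1 hi
      have hj' := Finset.mem_range.1 hj
      exact hp.getVert_injOn (by simp; omega) (by simp; omega) hij
    _ ≤ _ := Finset.card_le_card hsub

/-- A connected component has a `2h`-net of small size. -/
theorem exists_net (G : SimpleGraph V) (h : ℕ) (v₀ : V) : ∃ Z : Finset V,
    (Z.card : ℝ) ≤ 1 + Fintype.card V / (h + 1) ∧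
      ∀ u, G.Reachable v₀ u → ∃ z ∈ Z, z ∈ wball G (2 * h) u := by
  classical
  -- A largest set of vertices of the component at pairwise distance above 2h is a net. Its
  -- `h`-balls are disjoint and, if there are two of them, have at least h + 1 vertices each; the
  -- summand 1 covers a single ball.
  let sep : Finset V → Prop := fun Z => (∀ z ∈ Z, G.Reachable v₀ z) ∧
    ∀ z ∈ Z, ∀ z' ∈ Z, z ≠ z' → z' ∉ wball G (2 * h) z
  obtain ⟨Z, hZ, hmax⟩ := Finset.exists_max_image (Finset.univ.filter sep) Finset.card
    ⟨∅, by simp [sep]⟩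
  rw [Finset.mem_filter] at hZ
  obtain ⟨-, hreach, hsep⟩ := hZ
  refine ⟨Z, ?_, fun u hu => ?_⟩
  · rcases le_or_gt Z.card 1 with h1 | h1
    · have : (Z.card : ℝ) ≤ 1 := by exact_mod_cast h1
      have : (0 : ℝ) ≤ Fintype.card V / (h + 1) := by positivity
      linarith
    · have hball : ∀ z ∈ Z, h + 1 ≤ (wball G h z).card := by
        intro z hz
        obtain ⟨z', hz', hne⟩ := Finset.exists_mem_ne h1 z
        exact succ_le_card_wball ((hreach z hz).symm.trans (hreach z' hz')) fun hm =>
          hsep z hz z' hz' hne.symm (wball_mono (by omega) hm)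
      have hdisj : (Z : Set V).PairwiseDisjoint (wball G h) := by
        intro z hz z' hz' hne
        rw [Function.onFun, Finset.disjoint_left]
        intro a ha ha'
        refine hsep z hz z' hz' hne ?_
        rw [two_mul]
        exact wball_trans ha (wball_comm.1 ha')
      have hc : Z.card * (h + 1) ≤ Fintype.card V :=
        calc Z.card * (h + 1) ≤ ∑ z ∈ Z, (wball G h z).card := by
              rw [← smul_eq_mul]; exact Finset.card_nsmul_le_sum _ _ _ hball
          _ = (Z.biUnion (wball G h)).card := (Finset.card_biUnion hdisj).symm
          _ ≤ _ := Finset.card_le_univ _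
      have hc' : (Z.card : ℝ) * (h + 1) ≤ Fintype.card V := by exact_mod_cast hc
      have : (Z.card : ℝ) ≤ Fintype.card V / (h + 1) := by
        rw [le_div_iff₀ (by positivity)]; exact hc'
      linarith
  · by_contra hcon
    push Not at hcon
    have huZ : u ∉ Z := fun h => hcon u h (self_mem_wball _ _ _)
    have hins : sep (insert u Z) := by
      refine ⟨fun z hz => ?_, fun z hz z' hz' hne => ?_⟩
      · rcases Finset.mem_insert.1 hz with rfl | hz
        · exact hu
        · exact hreach z hz
      · rcases Finset.mem_insert.1 hz with h1 | h1 <;> rcases Finset.mem_insert.1 hz' with h2 | h2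
        · exact absurd (h1.trans h2.symm) hne
        · rw [h1]; exact hcon z' h2
        · rw [h2]; exact fun hm => hcon z h1 (wball_comm.1 hm)
        · exact hsep z h1 z' h2 hne
    have := hmax _ (Finset.mem_filter.2 ⟨Finset.mem_univ _, hins⟩)
    rw [Finset.card_insert_of_notMem huZ] at this
    omega

end Balls

/-! ### Walks lost by shrinking a vertex set -/

section Masks

variable {V : Type} [Fintype V] [DecidableEq V]

open scoped Classical in
/-- The adjacency matrix with the edges not inside `S` removed. -/
noncomputable def maskM (G : SimpleGraph V) (S : Finset V) : Matrix V V ℝ :=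
  fun i j => if i ∈ S ∧ j ∈ S then adjM G i j else 0

theorem maskM_symm (G : SimpleGraph V) (S : Finset V) : (maskM G S).IsSymm := by
  ext i j
  simp only [Matrix.transpose_apply, maskM, and_comm, adjM_symm G j i]

theorem maskM_nonneg (G : SimpleGraph V) (S : Finset V) (i j : V) : 0 ≤ maskM G S i j := by
  unfold maskM; split_ifs
  · exact adjM_nonneg G i j
  · exact le_rfl

theorem maskM_mono (G : SimpleGraph V) {S T : Finset V} (h : S ⊆ T) (i j : V) :
    maskM G S i j ≤ maskM G T i j := by
  by_cases hS : i ∈ S ∧ j ∈ S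
  · have hT : i ∈ T ∧ j ∈ T := ⟨h hS.1, h hS.2⟩
    simp [maskM, hS, hT]
  · have : maskM G S i j = 0 := by simp only [maskM, hS, if_false]
    rw [this]; exact maskM_nonneg G T i j

theorem maskM_pow_eq_zero (G : SimpleGraph V) (S : Finset V) (n : ℕ) {u : V} (hu : u ∉ S) (w : V) :
    (maskM G S ^ (n + 1)) u w = 0 := by
  rw [pow_succ', Matrix.mul_apply]
  exact Finset.sum_eq_zero fun k _ => by simp [maskM, hu]

theorem maskM_pow_eq_zero' (G : SimpleGraph V) (S : Finset V) (n : ℕ) {u : V} (hu : u ∉ S) (w : V) :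
    (maskM G S ^ (n + 1)) w u = 0 := by
  have := (isSymm_pow (maskM_symm G S) (n + 1)).apply u w
  rw [this]; exact maskM_pow_eq_zero G S n hu w

theorem maskM_adj {G : SimpleGraph V} {S : Finset V} {u w : V} (hu : u ∈ S) (hw : w ∈ S)
    (h : G.Adj u w) : maskM G S u w = 1 := by
  simp [maskM, adjM, hu, hw, h]

theorem maskM_le_one (G : SimpleGraph V) (S : Finset V) (u w : V) : maskM G S u w ≤ 1 := by
  unfold maskM adjM; split_ifs <;> norm_num

/-- Walks of length `n` from `u` inside `T'` outnumber those inside `T`. -/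
def Escapes (G : SimpleGraph V) (T T' : Finset V) (n : ℕ) (u : V) : Prop :=
  ∃ w, (maskM G T ^ n) u w + 1 ≤ (maskM G T' ^ n) u w

/-- The walk oscillating along the edge between `z` and `u` has any prescribed length. -/
theorem one_le_maskM_pow {G : SimpleGraph V} {T' : Finset V} {z u : V} (hz : z ∈ T') (hu : u ∈ T')
    (h : G.Adj z u) (n : ℕ) : ∃ w, 1 ≤ (maskM G T' ^ n) z w := by
  have key : ∀ a ∈ ({z, u} : Finset V), ∃ w, 1 ≤ (maskM G T' ^ n) a w := by
    induction n with
    | zero => intro a _; exact ⟨a, by simp⟩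
    | succ n ih =>
      have step : ∀ a b, maskM G T' a b = 1 → (∃ w, 1 ≤ (maskM G T' ^ n) b w) →
          ∃ w, 1 ≤ (maskM G T' ^ (n + 1)) a w := by
        rintro a b hab ⟨w, hw⟩
        refine ⟨w, ?_⟩
        rw [pow_succ', Matrix.mul_apply]
        refine le_trans ?_ (Finset.single_le_sum (fun k _ => mul_nonneg (maskM_nonneg G T' a k)
          (pow_nonneg_entries (maskM_nonneg G T') n k w)) (Finset.mem_univ b))
        rw [hab, one_mul]; exact hw
      intro a ha
      rcases Finset.mem_insert.1 ha with rfl | ha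
      · exact step _ u (maskM_adj hz hu h) (ih u (by simp))
      · rw [Finset.mem_singleton.1 ha]
        exact step _ z (maskM_adj hu hz h.symm) (ih z (by simp))
  exact key z (by simp)

theorem escapes_of_notMem {G : SimpleGraph V} {T T' : Finset V} {z u : V} (hz : z ∈ T')
    (hu : u ∈ T') (h : G.Adj z u) (hzT : z ∉ T) (n : ℕ) : Escapes G T T' (n + 1) z := by
  obtain ⟨w, hw⟩ := one_le_maskM_pow hz hu h (n + 1)
  exact ⟨w, by rw [maskM_pow_eq_zero G T n hzT]; linarith⟩

theorem escapes_succ {G : SimpleGraph V} {T T' : Finset V} (hTT' : T ⊆ T') {z u : V} (hz : z ∈ T')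
    (hu : u ∈ T') (h : G.Adj u z) {n : ℕ} (hn : Escapes G T T' n z) :
    Escapes G T T' (n + 1) u := by
  obtain ⟨w, hw⟩ := hn
  refine ⟨w, ?_⟩
  rw [pow_succ', pow_succ', Matrix.mul_apply, Matrix.mul_apply,
    ← Finset.add_sum_erase _ _ (Finset.mem_univ z), ← Finset.add_sum_erase _ _ (Finset.mem_univ z)]
  have h1 : ∑ k ∈ Finset.univ.erase z, maskM G T u k * (maskM G T ^ n) k w ≤
      ∑ k ∈ Finset.univ.erase z, maskM G T' u k * (maskM G T' ^ n) k w :=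
    Finset.sum_le_sum fun k _ => mul_le_mul (maskM_mono G hTT' u k)
      (pow_le_pow_entries (maskM_nonneg G T) (maskM_mono G hTT') n k w)
      (pow_nonneg_entries (maskM_nonneg G T) n k w) (maskM_nonneg G T' u k)
  have h2 : maskM G T u z * (maskM G T ^ n) z w ≤ (maskM G T ^ n) z w :=
    mul_le_of_le_one_left (pow_nonneg_entries (maskM_nonneg G T) n z w) (maskM_le_one G T u z)
  rw [maskM_adj hu hz h, one_mul]
  linarith

/-- A walk in `T'` that visits a vertex outside `T` is counted for `T'` only. Follow `p` until it
leaves `T`, then oscillate along an edge to reach length exactly `n`; the positive length of `p`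
provides that edge. -/
theorem escapes_of_walk {G : SimpleGraph V} {T T' : Finset V} (hTT' : T ⊆ T') {u z : V}
    (p : G.Walk u z) (hp : ∀ y ∈ p.support, y ∈ T') (hzT : z ∉ T) (hlen : 0 < p.length)
    {n : ℕ} (hn : p.length ≤ n) : Escapes G T T' n u := by
  induction p generalizing n with
  | nil => simp at hlen
  | @cons u b z h q ih =>
    have huT' : u ∈ T' := hp u (by simp)
    have hbT' : b ∈ T' := hp b (by simp)
    rw [SimpleGraph.Walk.length_cons] at hn
    obtain ⟨m, rfl⟩ : ∃ m, n = m + 1 := ⟨n - 1, by omega⟩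
    by_cases huT : u ∈ T
    swap
    · exact escapes_of_notMem huT' hbT' h huT m
    by_cases hq : 0 < q.length
    · exact escapes_succ hTT' hbT' huT' h
        (ih (fun y hy => hp y (by simp [hy])) hzT hq (by omega))
    · have hbz : b = z := SimpleGraph.Walk.eq_of_length_eq_zero (by omega : q.length = 0)
      subst hbz
      cases m with
      | zero =>
        refine ⟨b, ?_⟩
        rw [zero_add, pow_one, pow_one, maskM_adj huT' hbT' h]
        simp [maskM, hzT]
      | succ m => exact escapes_succ hTT' hbT' huT' h (escapes_of_notMem hbT' huT' h.symm hzT m)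

theorem diag_pow_two_mul {B : Matrix V V ℝ} (hB : B.IsSymm) (n : ℕ) (u : V) :
    (B ^ (2 * n)) u u = ∑ w, ((B ^ n) u w) ^ 2 := by
  rw [two_mul, pow_add, Matrix.mul_apply]
  refine Finset.sum_congr rfl fun w _ => ?_
  rw [(isSymm_pow hB n).apply u w, sq]

/-- The diagonal entry is the sum of squares of a row of the n-th power, and a nonnegative entry
that grows by 1 has a square that grows by at least 1. -/
theorem diag_add_one_le {G : SimpleGraph V} {T T' : Finset V} (hTT' : T ⊆ T') {n : ℕ} {u : V}
    (h : Escapes G T T' n u) :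
    (maskM G T ^ (2 * n)) u u + 1 ≤ (maskM G T' ^ (2 * n)) u u := by
  obtain ⟨w, hw⟩ := h
  rw [diag_pow_two_mul (maskM_symm G T), diag_pow_two_mul (maskM_symm G T'),
    ← Finset.add_sum_erase _ _ (Finset.mem_univ w), ← Finset.add_sum_erase _ _ (Finset.mem_univ w)]
  have h1 : ∑ k ∈ Finset.univ.erase w, ((maskM G T ^ n) u k) ^ 2 ≤
      ∑ k ∈ Finset.univ.erase w, ((maskM G T' ^ n) u k) ^ 2 :=
    Finset.sum_le_sum fun k _ => pow_le_pow_left₀ (pow_nonneg_entries (maskM_nonneg G T) n u k)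
      (pow_le_pow_entries (maskM_nonneg G T) (maskM_mono G hTT') n u k) 2
  have h2 := pow_nonneg_entries (maskM_nonneg G T) n u w
  nlinarith

end Masks

/-! ### Sublinear multiplicity in one component -/

section Multiplicity

variable {V : Type} [Fintype V] [DecidableEq V]

/-- Entries are nonnegative, so the form at `x` is bounded by the form at |x| cut down to `S`. -/
theorem maskM_form_le {G : SimpleGraph V} {S : Finset V} {lam : ℝ} (hlam : 0 ≤ lam)
    (h : ∀ y : V → ℝ, (∀ i ∉ S, y i = 0) → y ⬝ᵥ (adjM G).mulVec y ≤ lam * (y ⬝ᵥ y)) (x : V → ℝ) :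
    |x ⬝ᵥ (maskM G S).mulVec x| ≤ lam * (x ⬝ᵥ x) := by
  classical
  set y : V → ℝ := fun i => if i ∈ S then |x i| else 0 with hy
  have hyx : y ⬝ᵥ y ≤ x ⬝ᵥ x := by
    refine Finset.sum_le_sum fun i _ => ?_
    by_cases hi : i ∈ S
    · simp [hy, hi]
    · simp only [hy, hi, if_false, mul_zero]; exact mul_self_nonneg _
  have hform : |x| ⬝ᵥ (maskM G S).mulVec |x| = y ⬝ᵥ (adjM G).mulVec y := by
    rw [form_eq_sum, form_eq_sum]
    refine Finset.sum_congr rfl fun i _ => Finset.sum_congr rfl fun j _ => ?_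
    by_cases hi : i ∈ S <;> by_cases hj : j ∈ S <;> simp [hy, maskM, hi, hj]
  refine (form_le_form_abs (maskM_nonneg G S) x).trans ?_
  rw [hform]
  exact (h y fun i hi => by simp [hy, hi]).trans (mul_le_mul_of_nonneg_left hyx hlam)

/-- Deleting a net lowers the norm of powers of the adjacency matrix. -/
theorem maskM_pow_form_le {G : SimpleGraph V} {T T' : Finset V} (hTT' : T ⊆ T') {lam : ℝ}
    (hlam : 0 ≤ lam)
    (h : ∀ y : V → ℝ, (∀ i ∉ T', y i = 0) → y ⬝ᵥ (adjM G).mulVec y ≤ lam * (y ⬝ᵥ y))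
    {n : ℕ} (hn : 0 < n) (hesc : ∀ u ∈ T, Escapes G T T' n u) (x : V → ℝ) :
    |x ⬝ᵥ (maskM G T ^ (2 * n)).mulVec x| ≤ max (lam ^ (2 * n) - 1) 0 * (x ⬝ᵥ x) := by
  classical
  rw [form_pow_two_mul (maskM_symm G T), abs_of_nonneg (dot_self_nonneg _),
    ← form_pow_two_mul (maskM_symm G T)]
  set y : V → ℝ := fun i => if i ∈ T then |x i| else 0 with hy
  have hy0 : ∀ i, 0 ≤ y i := fun i => by simp only [hy]; split_ifs <;> positivity
  have hyx : y ⬝ᵥ y ≤ x ⬝ᵥ x := by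
    refine Finset.sum_le_sum fun i _ => ?_
    by_cases hi : i ∈ T
    · simp [hy, hi]
    · simp only [hy, hi, if_false, mul_zero]; exact mul_self_nonneg _
  have hC0 := pow_nonneg_entries (maskM_nonneg G T) (2 * n)
  obtain ⟨m, hm⟩ : ∃ m, 2 * n = m + 1 := ⟨2 * n - 1, by omega⟩
  have h1 : x ⬝ᵥ (maskM G T ^ (2 * n)).mulVec x ≤ y ⬝ᵥ (maskM G T ^ (2 * n)).mulVec y := by
    rw [form_eq_sum, form_eq_sum]
    refine Finset.sum_le_sum fun i _ => Finset.sum_le_sum fun j _ => ?_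
    by_cases hi : i ∈ T
    · by_cases hj : j ∈ T
      · refine (le_abs_self _).trans (le_of_eq ?_)
        rw [abs_mul, abs_mul, abs_of_nonneg (hC0 i j)]
        simp [hy, hi, hj]
      · rw [hm, maskM_pow_eq_zero' G T m hj]; simp
    · rw [hm, maskM_pow_eq_zero G T m hi]; simp
  -- Entrywise, the power for `T'` dominates the power for `T` plus the identity on `T`, and `y` is
  -- nonnegative and supported on `T`.
  have h2 : y ⬝ᵥ (maskM G T ^ (2 * n)).mulVec y + y ⬝ᵥ y ≤
      y ⬝ᵥ (maskM G T' ^ (2 * n)).mulVec y := by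
    rw [form_eq_sum, form_eq_sum, dotProduct, ← Finset.sum_add_distrib]
    refine Finset.sum_le_sum fun i _ => ?_
    rw [← Finset.add_sum_erase _ _ (Finset.mem_univ i), ← Finset.add_sum_erase (a := i) _
      (fun j => y i * (maskM G T' ^ (2 * n)) i j * y j) (Finset.mem_univ i)]
    have e1 : ∑ j ∈ Finset.univ.erase i, y i * (maskM G T ^ (2 * n)) i j * y j ≤
        ∑ j ∈ Finset.univ.erase i, y i * (maskM G T' ^ (2 * n)) i j * y j := by
      refine Finset.sum_le_sum fun j _ => ?_
      have := pow_le_pow_entries (maskM_nonneg G T) (maskM_mono G hTT') (2 * n) i j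
      have := hy0 i
      have := hy0 j
      gcongr
    have e2 : y i * (maskM G T ^ (2 * n)) i i * y i + y i * y i ≤
        y i * (maskM G T' ^ (2 * n)) i i * y i := by
      by_cases hi : i ∈ T
      · have := diag_add_one_le hTT' (hesc i hi)
        nlinarith [mul_self_nonneg (y i)]
      · simp [hy, hi]
    linarith
  have h3 : y ⬝ᵥ (maskM G T' ^ (2 * n)).mulVec y ≤ lam ^ (2 * n) * (y ⬝ᵥ y) := by
    rw [form_pow_two_mul (maskM_symm G T')]
    exact pow_mulVec_dot_le (maskM_symm G T') hlam (maskM_form_le hlam h) n y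
  calc x ⬝ᵥ (maskM G T ^ (2 * n)).mulVec x ≤ (lam ^ (2 * n) - 1) * (y ⬝ᵥ y) := by linarith
    _ ≤ max (lam ^ (2 * n) - 1) 0 * (y ⬝ᵥ y) :=
      mul_le_mul_of_nonneg_right (le_max_left _ _) (dot_self_nonneg y)
    _ ≤ _ := mul_le_mul_of_nonneg_left hyx (le_max_right _ _)

/-- Powers applied to a basis vector only see a ball. -/
theorem maskM_pow_single (G : SimpleGraph V) (S : Finset V) (r : ℕ) (v : V) (j : ℕ)
    (hj : j ≤ r) : (maskM G S ^ j).mulVec (Pi.single v 1) =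
        (maskM G (S ∩ wball G r v) ^ j).mulVec (Pi.single v 1) ∧
      ∀ u ∉ wball G j v, (maskM G S ^ j).mulVec (Pi.single v 1) u = 0 := by
  induction j with
  | zero =>
    refine ⟨by simp, fun u hu => ?_⟩
    have : u ≠ v := fun h => hu (h ▸ self_mem_wball G 0 v)
    simp [this]
  | succ j ih =>
    obtain ⟨ih1, ih2⟩ := ih (by omega)
    have hsupp : ∀ u ∉ wball G (j + 1) v,
        (maskM G S ^ (j + 1)).mulVec (Pi.single v 1) u = 0 := by
      intro u hu
      rw [pow_succ', ← Matrix.mulVec_mulVec]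
      refine Finset.sum_eq_zero fun w _ => ?_
      by_cases hw : w ∈ wball G j v
      · have : ¬ G.Adj u w := fun h => hu (wball_trans hw (wball_one_of_adj h.symm))
        simp [maskM, adjM, this]
      · rw [ih2 w hw, mul_zero]
    refine ⟨?_, hsupp⟩
    ext u
    by_cases hu : u ∈ wball G r v
    · rw [pow_succ', pow_succ', ← Matrix.mulVec_mulVec, ← Matrix.mulVec_mulVec, ← ih1]
      refine Finset.sum_congr rfl fun w _ => ?_
      by_cases hw : w ∈ wball G j v
      · simp [maskM, hu, wball_mono (by omega : j ≤ r) hw]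
      · rw [ih2 w hw, mul_zero, mul_zero]
    · rw [hsupp u fun h => hu (wball_mono hj h), pow_succ', ← Matrix.mulVec_mulVec]
      refine (Finset.sum_eq_zero fun w _ => ?_).symm
      simp [maskM, hu]

/-- Two separated subgraphs cannot both have large top eigenvalue. -/
theorem GramNonneg.not_separated {G : SimpleGraph V} {lam : ℝ} (hM : GramNonneg G lam)
    {z w : V → ℝ} (hz : lam * (z ⬝ᵥ z) < z ⬝ᵥ (adjM G).mulVec z)
    (hw : lam * (w ⬝ᵥ w) ≤ w ⬝ᵥ (adjM G).mulVec w) (hw0 : w ≠ 0) :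
    ∃ i j, z i ≠ 0 ∧ w j ≠ 0 ∧ (i = j ∨ G.Adj i j) := by
  by_contra hsep
  push Not at hsep
  have hA := adjM_nonneg G
  have hz' : lam * (|z| ⬝ᵥ |z|) < |z| ⬝ᵥ (adjM G).mulVec |z| := by
    rw [abs_dot_abs]
    exact hz.trans_le ((le_abs_self _).trans (form_le_form_abs hA z))
  have hw' : lam * (|w| ⬝ᵥ |w|) ≤ |w| ⬝ᵥ (adjM G).mulVec |w| := by
    rw [abs_dot_abs]
    exact hw.trans ((le_abs_self _).trans (form_le_form_abs hA w))
  set a := ∑ i, |w| i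
  set b := ∑ i, |z| i
  have ha : 0 < a := by
    obtain ⟨j, hj⟩ := Function.ne_iff.1 hw0
    exact Finset.sum_pos' (fun i _ => abs_nonneg _) ⟨j, Finset.mem_univ _, abs_pos.2 hj⟩
  have d1 : |z| ⬝ᵥ |w| = 0 := by
    refine Finset.sum_eq_zero fun i _ => ?_
    by_contra hne
    have h1 : z i ≠ 0 := fun h => hne (by simp [h])
    have h2 : w i ≠ 0 := fun h => hne (by simp [h])
    exact (hsep i i h1 h2).1 rfl
  have d2 : |z| ⬝ᵥ (adjM G).mulVec |w| = 0 := by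
    rw [form_eq_sum]
    refine Finset.sum_eq_zero fun i _ => Finset.sum_eq_zero fun j _ => ?_
    by_contra hne
    have h1 : z i ≠ 0 := fun h => hne (by simp [h])
    have h2 : w j ≠ 0 := fun h => hne (by simp [h])
    exact hne (by simp [adjM, (hsep i j h1 h2).2])
  have d3 := (dotProduct_comm |w| |z|).trans d1
  have d4 := (form_comm (adjM_isSymm G) |w| |z|).trans d2
  -- This combination has sum zero and no cross terms, so the form is a² times a negative number
  -- plus b² times a nonpositive one.
  have h := hM (a • |z| - b • |w|)
  have hs : ∑ i, (a • |z| - b • |w|) i = 0 := by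
    simp only [Pi.sub_apply, Pi.smul_apply, smul_eq_mul, Finset.sum_sub_distrib, ← Finset.mul_sum]
    change a * b - b * a = 0
    ring
  rw [hs] at h
  simp only [Matrix.mulVec_sub, Matrix.mulVec_smul, dotProduct_sub, sub_dotProduct,
    dotProduct_smul, smul_dotProduct, smul_eq_mul, d1, d2, d3, d4] at h
  have h1 := mul_pos (mul_pos ha ha) (sub_pos.2 hz')
  have h2 := mul_nonneg (mul_self_nonneg b) (sub_nonneg.2 hw')
  nlinarith

/-- The price of imposing linear conditions: used for sum zero and for vanishing on deleted
vertices. -/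
theorem finrank_le_add_inf_ker {F : Type} [AddCommGroup F] [Module ℝ F] [Module.Finite ℝ F]
    (W : Submodule ℝ (V → ℝ)) (φ : (V → ℝ) →ₗ[ℝ] F) :
    Module.finrank ℝ W ≤ Module.finrank ℝ F +
      Module.finrank ℝ (W ⊓ LinearMap.ker φ : Submodule ℝ (V → ℝ)) := by
  have h := (φ.comp W.subtype).finrank_range_add_finrank_ker
  have h1 := Submodule.finrank_le (LinearMap.range (φ.comp W.subtype))
  have h2 : Module.finrank ℝ (LinearMap.ker (φ.comp W.subtype)) ≤
      Module.finrank ℝ (W ⊓ LinearMap.ker φ : Submodule ℝ (V → ℝ)) := by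
    let f := LinearMap.codRestrict (W ⊓ LinearMap.ker φ)
      (W.subtype.comp (LinearMap.ker (φ.comp W.subtype)).subtype) fun x => ⟨x.1.2, x.2⟩
    refine LinearMap.finrank_le_finrank_of_injective (f := f) fun x y hxy => ?_
    have h : (f x).1 = (f y).1 := congrArg _ hxy
    exact Subtype.ext (Subtype.ext h)
  omega

/-- Moments bound an eigenspace supported away from a net. -/
theorem finrank_eigenspace_le_of_net {G : SimpleGraph V} {S : Finset V} {lam : ℝ} (hlam : 0 < lam)
    {r₁ s : ℕ} (hr₁ : 0 < r₁) (hs : 0 < s)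
    (hnet : ∀ u ∈ S, ∃ z ∉ S, z ∈ wball G r₁ u)
    (hform : ∀ v ∈ S, ∀ y : V → ℝ, (∀ i ∉ wball G (2 * r₁ * s + r₁) v, y i = 0) →
      y ⬝ᵥ (adjM G).mulVec y ≤ lam * (y ⬝ᵥ y))
    (W : Submodule ℝ (V → ℝ)) (hW : ∀ x ∈ W, (adjM G).mulVec x = lam • x)
    (hWS : ∀ x ∈ W, ∀ i ∉ S, x i = 0) :
    (Module.finrank ℝ W : ℝ) ≤
      Fintype.card V * (max (lam ^ (2 * r₁) - 1) 0 / lam ^ (2 * r₁)) ^ (2 * s) := by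
  set c := max (lam ^ (2 * r₁) - 1) 0 with hc
  have hc0 : 0 ≤ c := le_max_right _ _
  have hWmask : ∀ x ∈ W, (maskM G S).mulVec x = lam • x := by
    intro x hx
    ext u
    by_cases hu : u ∈ S
    · rw [← hW x hx]
      refine Finset.sum_congr rfl fun w _ => ?_
      by_cases hw : w ∈ S
      · simp [maskM, hu, hw]
      · simp [hWS x hx w hw]
    · rw [Pi.smul_apply, hWS x hx u hu, smul_zero]
      exact Finset.sum_eq_zero fun w _ => by simp [maskM, hu]
  have hmom := finrank_mul_pow_le (maskM_symm G S) W lam hWmask (2 * r₁ * s)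
  have hterm : ∀ v, (maskM G S ^ (2 * r₁ * s)).mulVec (Pi.single v 1) ⬝ᵥ
      (maskM G S ^ (2 * r₁ * s)).mulVec (Pi.single v 1) ≤ c ^ (2 * s) := by
    intro v
    by_cases hv : v ∈ S
    · rw [(maskM_pow_single G S (2 * r₁ * s) v _ le_rfl).1]
      -- Only this ball matters for 2r₁s steps from `v`. The ball larger by `r₁` still satisfies the
      -- form bound and contains a walk from each vertex of `T` to a deleted vertex.
      set T := S ∩ wball G (2 * r₁ * s) v with hT
      have hTT' : T ⊆ wball G (2 * r₁ * s + r₁) v := fun u hu =>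
        wball_mono (by omega) (Finset.mem_inter.1 hu).2
      have hesc : ∀ u ∈ T, Escapes G T (wball G (2 * r₁ * s + r₁) v) r₁ u := by
        intro u hu
        obtain ⟨huS, hub⟩ := Finset.mem_inter.1 hu
        obtain ⟨z, hz, hzu⟩ := hnet u huS
        obtain ⟨p, hp⟩ := mem_wball.1 hzu
        refine escapes_of_walk hTT' p (fun y hy => wball_trans hub
          (mem_wball_of_mem_support p hp hy)) (fun h => hz (Finset.mem_inter.1 h).1) ?_ hp
        by_contra h0
        have := SimpleGraph.Walk.eq_of_length_eq_zero (p := p) (by omega)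
        exact hz (this ▸ huS)
      -- The 2r₁-th power has norm at most `c`; it is raised to the power `s`, and the resulting
      -- norm is squared.
      have h := pow_mulVec_dot_le (isSymm_pow (maskM_symm G T) (2 * r₁)) hc0
        (maskM_pow_form_le hTT' hlam.le (hform v hv) hr₁ hesc) s (Pi.single v 1)
      rw [← pow_mul] at h
      simpa using h
    · have : (maskM G S ^ (2 * r₁ * s)).mulVec (Pi.single v 1) = 0 := by
        obtain ⟨m, hm⟩ : ∃ m, 2 * r₁ * s = m + 1 :=
          ⟨2 * r₁ * s - 1, by have := Nat.mul_pos hr₁ hs; rw [mul_assoc]; omega⟩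
        ext u
        rw [hm, Matrix.mulVec_single_one]
        exact maskM_pow_eq_zero' G S m hv u
      rw [this, dotProduct_zero]
      positivity
  have hsum := hmom.trans (Finset.sum_le_sum fun v _ => hterm v)
  rw [Finset.sum_const, Finset.card_univ, nsmul_eq_mul] at hsum
  rw [div_pow, mul_div_assoc', le_div_iff₀ (by positivity), ← pow_mul]
  rwa [show 2 * r₁ * (2 * s) = 2 * (2 * r₁ * s) by ring]

/-- The eigenspace within a component of bounded degree has sublinear dimension. -/
theorem exists_finrank_component_le (lam : ℝ) (hlam : 0 < lam) (D : ℕ) (ε : ℝ) (hε : 0 < ε) :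
    ∃ C : ℝ, ∀ (V : Type) [Fintype V] [DecidableEq V] (G : SimpleGraph V), GramNonneg G lam →
      (∀ i, ∀ S : Finset V, (∀ j ∈ S, G.Adj i j) → S.card ≤ D) → ∀ (v₀ : V)
      (W : Submodule ℝ (V → ℝ)), (∀ x ∈ W, (adjM G).mulVec x = lam • x) →
      (∀ x ∈ W, ∀ u, ¬ G.Reachable v₀ u → x u = 0) →
      (Module.finrank ℝ W : ℝ) ≤ ε * Fintype.card V + C := by
  classical
  -- Half of ε pays for the net, the other half for the moment bound. The shifts to h + 1 and s + 1
  -- keep the radius and the exponent positive.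
  obtain ⟨h, hh⟩ := exists_nat_one_div_lt (half_pos hε)
  set r₁ := 2 * (h + 1) with hr₁
  set ρ := max (lam ^ (2 * r₁) - 1) 0 / lam ^ (2 * r₁) with hρ
  have hρ0 : 0 ≤ ρ := by positivity
  have hρ1 : ρ < 1 := by
    rw [hρ, div_lt_one (by positivity)]
    exact max_lt (by linarith) (by positivity)
  obtain ⟨s, hs⟩ := exists_pow_lt_of_lt_one (half_pos hε) hρ1
  set r := 2 * r₁ * (s + 1) + r₁ with hr
  refine ⟨1 + (D + 1) ^ (r + 1 + r), fun V _ _ G hM hD v₀ W hW hWs => ?_⟩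
  obtain ⟨Z₀, hZ₀, hnet⟩ := exists_net G (h + 1) v₀
  -- By `GramNonneg.not_separated`, the `r`-balls around two vertices of `U` meet or are joined by
  -- an edge, so `U` lies in a single ball of radius 2r + 1.
  set U : Finset V := Finset.univ.filter fun v => ∃ y : V → ℝ,
    (∀ i ∉ wball G r v, y i = 0) ∧ lam * (y ⬝ᵥ y) < y ⬝ᵥ (adjM G).mulVec y with hU
  have hUc : U.card ≤ (D + 1) ^ (r + 1 + r) := by
    rcases U.eq_empty_or_nonempty with h0 | ⟨v, hv⟩
    · rw [h0]; simp
    · refine le_trans (Finset.card_le_card fun u hu => ?_) (card_wball_le hD (r + 1 + r) v)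
      obtain ⟨-, y, hy, hyf⟩ := Finset.mem_filter.1 hv
      obtain ⟨-, z, hz, hzf⟩ := Finset.mem_filter.1 hu
      have hz0 : z ≠ 0 := fun h0 => by rw [h0] at hzf; simp at hzf
      obtain ⟨i, j, hi, hj, hij⟩ := hM.not_separated hyf hzf.le hz0
      have hi' : i ∈ wball G r v := by_contra fun hn => hi (hy i hn)
      have hj' : j ∈ wball G r u := by_contra fun hn => hj (hz j hn)
      refine wball_trans ?_ (wball_comm.1 hj')
      rcases hij with rfl | hij
      · exact wball_mono (by omega) hi'
      · exact wball_trans hi' (wball_one_of_adj hij)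
  set Z := Z₀ ∪ U with hZ
  set S : Finset V := Finset.univ.filter fun u => G.Reachable v₀ u ∧ u ∉ Z with hS
  let φ : (V → ℝ) →ₗ[ℝ] (Z → ℝ) := LinearMap.funLeft ℝ ℝ (Subtype.val : Z → V)
  have hfr := finrank_le_add_inf_ker W φ
  have hmain := finrank_eigenspace_le_of_net (G := G) (S := S) hlam (r₁ := r₁) (s := s + 1)
    (by omega) (by omega) ?_ ?_ (W ⊓ LinearMap.ker φ) (fun x hx => hW x hx.1) ?_
  · have h1 : ρ ^ (2 * (s + 1)) ≤ ε / 2 :=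
      (pow_le_pow_of_le_one hρ0 hρ1.le (by omega)).trans hs.le
    have h2 : (Fintype.card V : ℝ) * ρ ^ (2 * (s + 1)) ≤ Fintype.card V * (ε / 2) := by gcongr
    have h3 : (Fintype.card V : ℝ) / ((h + 1 : ℕ) + 1) ≤ Fintype.card V * (ε / 2) := by
      rw [div_eq_mul_one_div]
      refine mul_le_mul_of_nonneg_left (le_trans ?_ hh.le) (by positivity)
      push_cast
      exact one_div_le_one_div_of_le (by positivity) (by linarith)
    have h4 : (Module.finrank ℝ (Z → ℝ) : ℝ) ≤ Z₀.card + U.card := by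
      rw [Module.finrank_fintype_fun_eq_card, Fintype.card_coe]
      exact_mod_cast Finset.card_union_le _ _
    have h5 : (U.card : ℝ) ≤ (D + 1) ^ (r + 1 + r) := by exact_mod_cast hUc
    have h6 : (Module.finrank ℝ W : ℝ) ≤ Module.finrank ℝ (Z → ℝ) +
        Module.finrank ℝ (W ⊓ LinearMap.ker φ : Submodule ℝ (V → ℝ)) := by exact_mod_cast hfr
    linarith
  · intro u hu
    obtain ⟨-, hur, -⟩ := Finset.mem_filter.1 hu
    obtain ⟨z, hz, hzu⟩ := hnet u hur
    exact ⟨z, fun hzS => (Finset.mem_filter.1 hzS).2.2 (Finset.mem_union_left _ hz), hzu⟩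
  · intro v hv y hy
    by_contra hcon
    push Not at hcon
    exact (Finset.mem_filter.1 hv).2.2 (Finset.mem_union_right _
      (Finset.mem_filter.2 ⟨Finset.mem_univ _, y, hy, hcon⟩))
  · intro x hx i hi
    by_cases hr : G.Reachable v₀ i
    · have hiZ : i ∈ Z := by
        by_contra hn
        exact hi (Finset.mem_filter.2 ⟨Finset.mem_univ _, hr, hn⟩)
      exact congrFun (LinearMap.mem_ker.1 hx.2) ⟨i, hiZ⟩
    · exact hWs x hx.1 i hr

end Multiplicity

/-! ### The kernel of λ - A + J/2 -/

section Kernel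

variable {V : Type} [Fintype V] [DecidableEq V]

/-- The kernel of `x - A + J / 2`. -/
noncomputable def gramKer (G : SimpleGraph V) (lam : ℝ) : Submodule ℝ (V → ℝ) where
  carrier := {x | ∀ j, lam * x j - (adjM G).mulVec x j + (∑ i, x i) / 2 = 0}
  zero_mem' := by intro j; simp
  add_mem' := by
    intro x y hx hy j
    have := hx j
    have := hy j
    simp only [Matrix.mulVec_add, Pi.add_apply, Finset.sum_add_distrib]
    linarith
  smul_mem' := by
    intro c x hx j
    have := hx j
    simp only [Matrix.mulVec_smul, Pi.smul_apply, smul_eq_mul, ← Finset.mul_sum]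
    linear_combination c * this

/-- The `x`-eigenspace of the adjacency matrix. -/
noncomputable def adjEigenspace (G : SimpleGraph V) (lam : ℝ) : Submodule ℝ (V → ℝ) where
  carrier := {x | (adjM G).mulVec x = lam • x}
  zero_mem' := by simp
  add_mem' := by
    intro x y hx hy
    simp only [Set.mem_ofPred_eq] at *
    rw [Matrix.mulVec_add, hx, hy, smul_add]
  smul_mem' := by
    intro c x hx
    simp only [Set.mem_ofPred_eq] at *
    rw [Matrix.mulVec_smul, hx, smul_comm]

/-- The sum of the entries of a vector. -/
def sumMap (V : Type) [Fintype V] : (V → ℝ) →ₗ[ℝ] ℝ where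
  toFun x := ∑ i, x i
  map_add' x y := by simp [Finset.sum_add_distrib]
  map_smul' c x := by simp [Finset.mul_sum]

theorem gramKer_inf_le (G : SimpleGraph V) (lam : ℝ) :
    gramKer G lam ⊓ LinearMap.ker (sumMap V) ≤ adjEigenspace G lam := by
  intro x hx
  obtain ⟨h1, h2⟩ := hx
  have h2' : ∑ i, x i = 0 := h2
  ext j
  have := h1 j
  rw [h2'] at this
  rw [Pi.smul_apply, smul_eq_mul]
  linarith

/-- A canonical vertex of the connected component of `i`. -/
noncomputable def compRep (G : SimpleGraph V) (i : V) : V := (G.connectedComponentMk i).out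

theorem compRep_eq_iff {G : SimpleGraph V} {i j : V} :
    compRep G i = compRep G j ↔ G.Reachable i j := by
  rw [← SimpleGraph.ConnectedComponent.eq]
  refine ⟨fun h => ?_, fun h => by rw [compRep, compRep, h]⟩
  have hi : G.connectedComponentMk (compRep G i) = G.connectedComponentMk i := Quot.out_eq _
  have hj : G.connectedComponentMk (compRep G j) = G.connectedComponentMk j := Quot.out_eq _
  rw [← hi, h, hj]

theorem reachable_compRep (G : SimpleGraph V) (i : V) : G.Reachable (compRep G i) i :=
  SimpleGraph.ConnectedComponent.exact (Quot.out_eq _)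

/-- No edge joins two components, so both sides split into sums over components and one summand must
violate the bound. -/
theorem exists_component_violator {G : SimpleGraph V} {lam : ℝ} {z : V → ℝ}
    (hz : lam * (z ⬝ᵥ z) < z ⬝ᵥ (adjM G).mulVec z) :
    ∃ v₀, ∃ y : V → ℝ, (∀ i, y i ≠ 0 → G.Reachable v₀ i) ∧
      lam * (y ⬝ᵥ y) < y ⬝ᵥ (adjM G).mulVec y := by
  classical
  let y : V → V → ℝ := fun v i => if compRep G i = v then z i else 0
  have h1 : ∑ v, y v ⬝ᵥ y v = z ⬝ᵥ z := by
    simp only [dotProduct]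
    rw [Finset.sum_comm]
    exact Finset.sum_congr rfl fun i _ => by simp [y]
  have h2 : ∑ v, y v ⬝ᵥ (adjM G).mulVec (y v) = z ⬝ᵥ (adjM G).mulVec z := by
    simp only [form_eq_sum]
    rw [Finset.sum_comm]
    refine Finset.sum_congr rfl fun i _ => ?_
    rw [Finset.sum_comm]
    refine Finset.sum_congr rfl fun j _ => ?_
    by_cases hij : G.Adj i j
    · have : compRep G i = compRep G j := compRep_eq_iff.2 hij.reachable
      rw [Finset.sum_eq_single (compRep G i)]
      · simp [y, this]
      · intro v _ hv; simp [y, hv.symm]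
      · simp
    · simp [adjM, hij]
  rw [← h1, ← h2, Finset.mul_sum] at hz
  obtain ⟨v, -, hv⟩ := Finset.exists_lt_of_sum_lt hz
  refine ⟨v, y v, fun i hi => ?_, hv⟩
  have : compRep G i = v := by_contra fun h => hi (by simp [y, h])
  rw [← this]; exact reachable_compRep G i

/-- Cutting `x` down to the complement of the component gives an eigenvector separated from `z`,
which must therefore vanish. -/
theorem GramNonneg.eq_zero_of_not_reachable {G : SimpleGraph V} {lam : ℝ} (hM : GramNonneg G lam)
    {v₀ : V} {z : V → ℝ} (hz : ∀ i, z i ≠ 0 → G.Reachable v₀ i)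
    (hzf : lam * (z ⬝ᵥ z) < z ⬝ᵥ (adjM G).mulVec z) {x : V → ℝ}
    (hx : (adjM G).mulVec x = lam • x) (u : V) (hu : ¬ G.Reachable v₀ u) : x u = 0 := by
  classical
  set y : V → ℝ := fun i => if G.Reachable v₀ i then 0 else x i with hy
  by_contra hxu
  have hy0 : y ≠ 0 := fun h => hxu (by simpa [hy, hu] using congrFun h u)
  have hAy : (adjM G).mulVec y = lam • y := by
    ext i
    by_cases hi : G.Reachable v₀ i
    · have : y i = 0 := by simp [hy, hi]
      rw [Pi.smul_apply, this, smul_zero]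
      refine Finset.sum_eq_zero fun j _ => ?_
      by_cases hij : G.Adj i j
      · simp [hy, hi.trans hij.reachable]
      · simp [adjM, hij]
    · have : y i = x i := by simp [hy, hi]
      rw [Pi.smul_apply, this, ← Pi.smul_apply, ← hx]
      refine Finset.sum_congr rfl fun j _ => ?_
      by_cases hij : G.Adj i j
      · have : ¬ G.Reachable v₀ j := fun h => hi (h.trans hij.symm.reachable)
        simp [hy, this]
      · simp [adjM, hij]
  obtain ⟨i, j, hi, hj, hij⟩ := hM.not_separated hzf
    (by rw [hAy, dotProduct_smul, smul_eq_mul]) hy0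
  have hj' : ¬ G.Reachable v₀ j := fun h => hj (by simp [hy, h])
  rcases hij with rfl | hij
  · exact hj' (hz i hi)
  · exact hj' ((hz i hi).trans hij.reachable)

theorem sum_equivFin (S : Finset V) (f : V → ℝ) (hf : ∀ i ∉ S, f i = 0) :
    ∑ i, f i = ∑ a : Fin S.card, f (S.equivFin.symm a) := by
  rw [Equiv.sum_comp S.equivFin.symm (fun i : S => f i), Finset.sum_coe_sort S f]
  exact (Finset.sum_subset (Finset.subset_univ S) fun i _ hi => hf i hi).symm

/-! ### Perron–Frobenius arguments when A ≤ λ -/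

section TopLe

variable {G : SimpleGraph V} {lam : ℝ}
  (hA : ∀ z : V → ℝ, z ⬝ᵥ (adjM G).mulVec z ≤ lam * (z ⬝ᵥ z))

include hA

theorem mulVec_eq_of_form_eq {x : V → ℝ} (hx : lam * (x ⬝ᵥ x) ≤ x ⬝ᵥ (adjM G).mulVec x) :
    (adjM G).mulVec x = lam • x := by
  set y := lam • x - (adjM G).mulVec x with hy
  have hyy : y = 0 := by
    rw [← dotProduct_self_eq_zero]
    by_contra hne
    have hp : 0 < y ⬝ᵥ y := lt_of_le_of_ne (dot_self_nonneg y) (Ne.symm hne)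
    set p := y ⬝ᵥ y with hpdef
    set q := lam * (y ⬝ᵥ y) - y ⬝ᵥ (adjM G).mulVec y with hq
    have hq0 : 0 ≤ q := sub_nonneg.2 (hA y)
    have hpe : p = lam * (y ⬝ᵥ x) - y ⬝ᵥ (adjM G).mulVec x := by
      rw [hpdef]
      conv_lhs => rw [hy, dotProduct_comm]
      rw [← hy, dotProduct_comm, dotProduct_sub, dotProduct_smul, smul_eq_mul]
    -- Moving from `x` to x - ty changes the form of λ - A by -2tp + t²q, which is negative since tq
    -- < p. The added 1 guards against q = 0.
    set t := p / (q + 1) with ht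
    have h := hA (x - t • y)
    have e1 := dotProduct_comm x y
    have e2 := form_comm (adjM_isSymm G) x y
    simp only [Matrix.mulVec_sub, Matrix.mulVec_smul, dotProduct_sub, sub_dotProduct,
      dotProduct_smul, smul_dotProduct, smul_eq_mul, e1, e2] at h
    have h3 : 2 * t * p ≤ t * (t * q) := by
      rw [hpe, hq]; nlinarith
    have ht0 : 0 < t := by positivity
    have h4 : 2 * p ≤ t * q := by
      have : t * (2 * p) ≤ t * (t * q) := by linarith
      exact le_of_mul_le_mul_left this ht0
    have h5 : t * (q + 1) = p := by rw [ht]; field_simp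
    nlinarith
  exact (sub_eq_zero.1 hyy).symm

theorem abs_mem_eigenspace {x : V → ℝ} (hx : (adjM G).mulVec x = lam • x) :
    (adjM G).mulVec |x| = lam • |x| := by
  refine mulVec_eq_of_form_eq hA ?_
  rw [abs_dot_abs]
  refine le_trans (le_of_eq ?_) ((le_abs_self _).trans (form_le_form_abs (adjM_nonneg G) x))
  rw [hx, dotProduct_smul, smul_eq_mul]

/-- |x| is an eigenvector as well; where it vanishes, its nonnegative values at the neighbours sum
to zero, so zeros spread along edges. -/
theorem eigenvector_eq_zero_of_reachable {x : V → ℝ} (hx : (adjM G).mulVec x = lam • x) {i j : V}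
    (hij : G.Reachable i j) (hi : x i = 0) : x j = 0 := by
  have habs := abs_mem_eigenspace hA hx
  obtain ⟨p⟩ := hij
  induction p with
  | nil => exact hi
  | @cons a b c h q ih =>
    refine ih ?_
    have h1 := congrFun habs a
    have h2 : (lam • |x|) a = 0 := by simp [hi]
    rw [h2] at h1
    have h3 := (Finset.sum_eq_zero_iff_of_nonneg (fun k _ =>
      mul_nonneg (adjM_nonneg G a k) (abs_nonneg (x k)))).1 h1 b (Finset.mem_univ b)
    have h4 : adjM G a b = 1 := by simp [adjM, h]
    rw [h4, one_mul] at h3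
    exact abs_eq_zero.1 h3

/-- `S` is a union of components, so `x` restricts to an eigenvector of the induced graph. Extending
any other eigenvector by zero and applying `hA` shows that λ is the largest eigenvalue there. -/
theorem spectralRadiusOrder_le_card {S : Finset V} (hS : ∀ i ∈ S, ∀ j, G.Adj i j → j ∈ S)
    {x : V → ℝ} (hx : (adjM G).mulVec x = lam • x) {v : V} (hv : v ∈ S) (hxv : x v ≠ 0) :
    spectralRadiusOrder lam ≤ (S.card : ℕ∞) := by
  classical
  refine sInf_le ⟨S.card, rfl, G.comap fun a => (S.equivFin.symm a : V), ?_, ?_⟩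
  · refine Module.End.hasEigenvalue_of_hasEigenvector
      (x := fun a => x (S.equivFin.symm a : V)) ⟨?_, ?_⟩
    · rw [Module.End.mem_eigenspace_iff]
      ext a
      have h := congrFun hx (S.equivFin.symm a : V)
      rw [Matrix.mulVec, dotProduct, sum_equivFin S] at h
      · rw [Pi.smul_apply] at h
        rw [Pi.smul_apply, ← h, Matrix.toLin'_apply, Matrix.mulVec, dotProduct]
        refine Finset.sum_congr rfl fun b _ => ?_
        simp [adjM, SimpleGraph.adjMatrix_apply]
      · intro j hj
        have : ¬ G.Adj (S.equivFin.symm a : V) j := fun h' => hj (hS _ (S.equivFin.symm a).2 j h')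
        simp [adjM, this]
    · intro h0
      exact hxv (by simpa using congrFun h0 (S.equivFin ⟨v, hv⟩))
  · rintro μ hμ
    obtain ⟨y, hy⟩ := hμ.exists_hasEigenvector
    have hye := Module.End.mem_eigenspace_iff.1 hy.1
    set Y : V → ℝ := fun i => if h : i ∈ S then y (S.equivFin ⟨i, h⟩) else 0 with hY
    have hYe : ∀ a, Y (S.equivFin.symm a : V) = y a := by intro a; simp [hY]
    have hY0 : ∀ i ∉ S, Y i = 0 := by intro i hi; simp [hY, hi]
    have hdot : Y ⬝ᵥ Y = y ⬝ᵥ y := by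
      rw [dotProduct, sum_equivFin S _ fun i hi => by rw [hY0 i hi, zero_mul]]
      simp only [hYe]; rfl
    have hform : Y ⬝ᵥ (adjM G).mulVec Y = μ * (y ⬝ᵥ y) := by
      rw [← smul_eq_mul, ← dotProduct_smul, ← hye, dotProduct,
        sum_equivFin S _ fun i hi => by rw [hY0 i hi, zero_mul]]
      refine Finset.sum_congr rfl fun a _ => ?_
      rw [hYe, Matrix.mulVec, dotProduct,
        sum_equivFin S _ fun i hi => by rw [hY0 i hi, mul_zero], Matrix.toLin'_apply]
      congr 1
      refine Finset.sum_congr rfl fun b _ => ?_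
      rw [hYe]
      simp [adjM, SimpleGraph.adjMatrix_apply]
    have h := hA Y
    rw [hdot, hform] at h
    have hpos : 0 < y ⬝ᵥ y :=
      lt_of_le_of_ne (dot_self_nonneg y) fun h0 => hy.2 (dotProduct_self_eq_zero.1 h0.symm)
    exact le_of_mul_le_mul_right h hpos

/-- Here `m` counts the components that carry a λ-eigenvector. Quantifying over all `k` up to the
order treats finite and infinite order together. -/
theorem finrank_gramKer_of_top_le :
    Module.finrank ℝ (gramKer G lam) = 0 ∨ ∃ m : ℕ, Module.finrank ℝ (gramKer G lam) + 1 ≤ m ∧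
      ∀ k : ℕ, (k : ℕ∞) ≤ spectralRadiusOrder lam → m * k ≤ Fintype.card V := by
  classical
  have hker : gramKer G lam ≤ adjEigenspace G lam ⊓ LinearMap.ker (sumMap V) := by
    intro x hx
    have hsum : x ⬝ᵥ (fun j => lam * x j - (adjM G).mulVec x j + (∑ i, x i) / 2) = 0 :=
      Finset.sum_eq_zero fun j _ => mul_eq_zero_of_right _ (hx j)
    have hexp : x ⬝ᵥ (fun j => lam * x j - (adjM G).mulVec x j + (∑ i, x i) / 2) =
        lam * (x ⬝ᵥ x) - x ⬝ᵥ (adjM G).mulVec x + (∑ i, x i) ^ 2 / 2 := by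
      simp only [dotProduct, mul_add, mul_sub, Finset.sum_add_distrib, Finset.sum_sub_distrib,
        ← Finset.sum_mul, Finset.mul_sum]
      congr 1
      · congr 1
        exact Finset.sum_congr rfl fun i _ => by ring
      · ring
    have h1 := hA x
    have h2 : (∑ i, x i) ^ 2 = 0 := by
      have := sq_nonneg (∑ i, x i)
      linarith
    have h3 : x ∈ LinearMap.ker (sumMap V) := pow_eq_zero_iff two_ne_zero |>.1 h2
    exact ⟨gramKer_inf_le G lam ⟨hx, h3⟩, h3⟩
  -- Evaluation at these representatives is injective on the eigenspace, since an eigenvector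
  -- vanishing at one vertex vanishes on its whole component.
  set R : Finset V := Finset.univ.filter fun v => compRep G v = v ∧
    ∃ x ∈ adjEigenspace G lam, x v ≠ 0 with hR
  have hinj : Module.finrank ℝ (adjEigenspace G lam) ≤ R.card := by
    let f : adjEigenspace G lam →ₗ[ℝ] (R → ℝ) :=
      (LinearMap.funLeft ℝ ℝ (Subtype.val : R → V)).comp (adjEigenspace G lam).subtype
    have hf : Function.Injective f := by
      rw [← LinearMap.ker_eq_bot, LinearMap.ker_eq_bot']
      intro x hx
      ext i
      have hrep : compRep G (compRep G i) = compRep G i := compRep_eq_iff.2 (reachable_compRep G i)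
      refine eigenvector_eq_zero_of_reachable hA x.2 (reachable_compRep G i) ?_
      by_contra hne
      exact hne (congrFun hx ⟨compRep G i,
        Finset.mem_filter.2 ⟨Finset.mem_univ _, hrep, x.1, x.2, hne⟩⟩)
    have := LinearMap.finrank_le_finrank_of_injective hf
    rwa [Module.finrank_fintype_fun_eq_card, Fintype.card_coe] at this
  rcases R.eq_empty_or_nonempty with h0 | ⟨v, hv⟩
  · left
    have := Submodule.finrank_mono hker
    have := Submodule.finrank_mono (inf_le_left :
      adjEigenspace G lam ⊓ LinearMap.ker (sumMap V) ≤ adjEigenspace G lam)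
    rw [h0, Finset.card_empty] at hinj
    omega
  · refine Or.inr ⟨R.card, ?_, fun k hk => ?_⟩
    · obtain ⟨-, -, x, hx, hxv⟩ := Finset.mem_filter.1 hv
      -- |x| is an eigenvector of nonzero sum; this gains the 1 that turns d into d - 1 in the final
      -- formula.
      have hlt : adjEigenspace G lam ⊓ LinearMap.ker (sumMap V) < adjEigenspace G lam := by
        refine lt_of_le_of_ne inf_le_left fun h => ?_
        have h1 : |x| ∈ adjEigenspace G lam := abs_mem_eigenspace hA hx
        rw [← h] at h1
        have h2 : ∑ i, |x| i = 0 := h1.2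
        have := (Finset.sum_eq_zero_iff_of_nonneg (fun i _ => abs_nonneg (x i))).1 h2 v
          (Finset.mem_univ v)
        exact hxv (abs_eq_zero.1 this)
      have := Submodule.finrank_lt_finrank_of_lt hlt
      have := Submodule.finrank_mono hker
      omega
    · rw [← Finset.card_univ, Finset.card_eq_sum_card_fiberwise (s := Finset.univ) (f := compRep G) (t := Finset.univ)
        (fun _ _ => Finset.mem_coe.2 (Finset.mem_univ _))]
      refine le_trans ?_ (Finset.sum_le_sum_of_subset (Finset.subset_univ R))
      rw [← smul_eq_mul]
      refine Finset.card_nsmul_le_sum _ _ _ fun u hu => ?_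
      obtain ⟨-, hur, x, hx, hxu⟩ := Finset.mem_filter.1 hu
      refine Nat.cast_le.1 (hk.trans (spectralRadiusOrder_le_card hA ?_ hx (v := u) ?_ hxu))
      · intro i hi j hij
        rw [Finset.mem_filter] at hi ⊢
        exact ⟨Finset.mem_univ _, (compRep_eq_iff.2 hij.symm.reachable).trans hi.2⟩
      · simp [hur]

end TopLe

/-- The nullity bound for negative graphs of bounded degree. -/
theorem exists_finrank_gramKer_le (lam : ℝ) (hlam : 0 < lam) (D : ℕ) (ε : ℝ) (hε : 0 < ε) :
    ∃ C : ℝ, ∀ (V : Type) [Fintype V] [DecidableEq V] (G : SimpleGraph V), GramNonneg G lam →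
      (∀ i, ∀ S : Finset V, (∀ j ∈ S, G.Adj i j) → S.card ≤ D) →
      (Module.finrank ℝ (gramKer G lam) : ℝ) ≤ ε * Fintype.card V + C ∨
      Module.finrank ℝ (gramKer G lam) = 0 ∨
      ∃ m : ℕ, Module.finrank ℝ (gramKer G lam) + 1 ≤ m ∧
        ∀ k : ℕ, (k : ℕ∞) ≤ spectralRadiusOrder lam → m * k ≤ Fintype.card V := by
  obtain ⟨C, hC⟩ := exists_finrank_component_le lam hlam D ε hε
  refine ⟨1 + C, fun V _ _ G hM hD => ?_⟩
  by_cases hA : ∀ z : V → ℝ, z ⬝ᵥ (adjM G).mulVec z ≤ lam * (z ⬝ᵥ z)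
  · exact Or.inr (finrank_gramKer_of_top_le hA)
  left
  push Not at hA
  obtain ⟨z, hz⟩ := hA
  obtain ⟨v₀, y, hy, hyf⟩ := exists_component_violator hz
  have h1 := hC V G hM hD v₀ (gramKer G lam ⊓ LinearMap.ker (sumMap V))
    (fun x hx => gramKer_inf_le G lam hx)
    (fun x hx u hu => hM.eq_zero_of_not_reachable hy hyf (gramKer_inf_le G lam hx) u hu)
  have h2 := finrank_le_add_inf_ker (gramKer G lam) (sumMap V)
  rw [Module.finrank_self] at h2
  have h3 : (Module.finrank ℝ (gramKer G lam) : ℝ) ≤ 1 + Module.finrank ℝ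
    (gramKer G lam ⊓ LinearMap.ker (sumMap V) : Submodule ℝ (V → ℝ)) := by exact_mod_cast h2
  linarith

end Kernel

/-! ### Passing between lines, vectors and graphs -/

section Lines

variable {d : ℕ}

theorem arccos_le_arccos_neg {α : ℝ} (hα : 0 < α) : Real.arccos α ≤ Real.pi - Real.arccos α := by
  rw [← Real.arccos_neg]
  exact Real.arccos_le_arccos (by linarith)

theorem exists_equiVecs {α : ℝ} (hα : 0 < α) (hα1 : α < 1) {n : ℕ}
    (hn : n ∈ equiangularSizes α d) :
    ∃ v : Fin n → EuclideanSpace ℝ (Fin d), EquiVecs α v := by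
  classical
  obtain ⟨L, rfl, hline, hang⟩ := hn
  have hex : ∀ l : L, ∃ u ∈ l.1, ‖u‖ = 1 := by
    intro l
    have h1 : Module.finrank ℝ l.1 = 1 := hline l.1 l.2
    have : Nontrivial l.1 := Module.nontrivial_of_finrank_pos (R := ℝ) (by omega)
    obtain ⟨u, hu⟩ := exists_ne (0 : l.1)
    have hu0 : (u : EuclideanSpace ℝ (Fin d)) ≠ 0 := fun h => hu (Subtype.ext h)
    refine ⟨(‖(u : EuclideanSpace ℝ (Fin d))‖)⁻¹ • (u : EuclideanSpace ℝ (Fin d)),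
      l.1.smul_mem _ u.2, ?_⟩
    rw [norm_smul, norm_inv, norm_norm, inv_mul_cancel₀ (norm_ne_zero_iff.2 hu0)]
  choose u hu hnorm using hex
  have hne : ∀ l, u l ≠ 0 := fun l h => by have := hnorm l; rw [h, norm_zero] at this; norm_num at this
  refine ⟨fun i => u (L.equivFin.symm i), fun i => ?_, fun i j hij => ?_⟩
  · rw [real_inner_self_eq_norm_sq, hnorm]; norm_num
  · set l := L.equivFin.symm i
    set m := L.equivFin.symm j
    have hlm : l.1 ≠ m.1 := fun h => hij (L.equivFin.symm.injective (Subtype.ext h))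
    have h := hang l.1 l.2 m.1 m.2 hlm (u l) (hu l) (u m) (hu m) (hne l) (hne m)
    have hcos : inner ℝ (u l) (u m) = Real.cos (InnerProductGeometry.angle (u l) (u m)) := by
      rw [InnerProductGeometry.cos_angle, hnorm, hnorm]; norm_num
    have hca : Real.cos (Real.arccos α) = α := Real.cos_arccos (by linarith) hα1.le
    rw [hcos]
    rcases min_choice (InnerProductGeometry.angle (u l) (u m))
      (Real.pi - InnerProductGeometry.angle (u l) (u m)) with h' | h'
    · left
      rw [h'] at h; rw [h, hca]
    · right
      rw [h'] at h
      rw [show InnerProductGeometry.angle (u l) (u m) = Real.pi - Real.arccos α by linarith,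
        Real.cos_pi_sub, hca]

theorem EquiVecs.card_mem {α : ℝ} (hα : 0 < α) (hα1 : α < 1) {V : Type} [Fintype V]
    {v : V → EuclideanSpace ℝ (Fin d)} (hv : EquiVecs α v) :
    Fintype.card V ∈ equiangularSizes α d := by
  classical
  have hne : ∀ i, v i ≠ 0 := fun i h => by have := hv.1 i; rw [h, inner_zero_left] at this; norm_num at this
  have hnorm : ∀ i, ‖v i‖ = 1 := fun i => by
    have := hv.1 i
    rw [real_inner_self_eq_norm_sq] at this
    exact (pow_eq_one_iff_of_nonneg (norm_nonneg _) two_ne_zero).1 this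
  have hinj : Function.Injective fun i => Submodule.span ℝ {v i} := by
    intro i j hij
    by_contra hne'
    have hmem : v j ∈ Submodule.span ℝ {v i} := by
      change Submodule.span ℝ {v i} = Submodule.span ℝ {v j} at hij
      rw [hij]; exact Submodule.mem_span_singleton_self _
    obtain ⟨c, hc⟩ := Submodule.mem_span_singleton.1 hmem
    have h1 : inner ℝ (v i) (v j) = c := by rw [← hc, inner_smul_right, hv.1, mul_one]
    have h2 : c * c = 1 := by
      have := hv.1 j
      rwa [← hc, inner_smul_left, inner_smul_right, hv.1, mul_one, conj_trivial] at this
    rcases hv.2 i j hne' with h | h <;> rw [h1] at h <;> rw [h] at h2 <;> nlinarith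
  refine ⟨Finset.univ.image fun i => Submodule.span ℝ {v i}, ?_, ?_, ?_⟩
  · rw [Finset.card_image_of_injective _ hinj, Finset.card_univ]
  · intro l hl
    obtain ⟨i, -, rfl⟩ := Finset.mem_image.1 hl
    exact finrank_span_singleton (hne i)
  · intro l hl m hm hlm u hu w hw hu0 hw0
    obtain ⟨i, -, rfl⟩ := Finset.mem_image.1 hl
    obtain ⟨j, -, rfl⟩ := Finset.mem_image.1 hm
    have hij : i ≠ j := fun h => hlm (by rw [h])
    obtain ⟨a, rfl⟩ := Submodule.mem_span_singleton.1 hu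
    obtain ⟨b, rfl⟩ := Submodule.mem_span_singleton.1 hw
    have ha : a ≠ 0 := fun h => hu0 (by rw [h, zero_smul])
    have hb : b ≠ 0 := fun h => hw0 (by rw [h, zero_smul])
    have key : InnerProductGeometry.angle (a • v i) (b • v j) = Real.arccos α ∨
        InnerProductGeometry.angle (a • v i) (b • v j) = Real.pi - Real.arccos α := by
      have hbase : InnerProductGeometry.angle (v i) (v j) = Real.arccos α ∨
          InnerProductGeometry.angle (v i) (v j) = Real.pi - Real.arccos α := by
        rw [← Real.arccos_neg, InnerProductGeometry.angle, hnorm, hnorm]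
        rcases hv.2 i j hij with h | h <;> rw [h] <;> norm_num
      rcases lt_or_gt_of_ne ha with ha | ha <;> rcases lt_or_gt_of_ne hb with hb | hb <;>
        simp only [InnerProductGeometry.angle_smul_left_of_neg, ha,
          InnerProductGeometry.angle_smul_right_of_neg, hb,
          InnerProductGeometry.angle_smul_left_of_pos,
          InnerProductGeometry.angle_smul_right_of_pos, InnerProductGeometry.angle_neg_left,
          InnerProductGeometry.angle_neg_right] <;>
        rcases hbase with h | h <;> rw [h] <;> simp
    have hle := arccos_le_arccos_neg hα
    rcases key with h | h <;> rw [h]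
    · exact min_eq_left hle
    · rw [sub_sub_cancel]; exact min_eq_right hle

-- Write M = B*B. The columns of `B` realise `M` and span a space of dimension rank M, which embeds
-- isometrically in ℝ^d.
open scoped MatrixOrder Matrix.Norms.L2Operator in
theorem exists_gram_vectors {V : Type} [Fintype V] [DecidableEq V] {M : Matrix V V ℝ}
    (hM : M.PosSemidef) (hr : M.rank ≤ d) :
    ∃ w : V → EuclideanSpace ℝ (Fin d), ∀ i j, inner ℝ (w i) (w j) = M i j := by
  obtain ⟨B, hB⟩ := CStarAlgebra.nonneg_iff_eq_star_mul_self.mp hM.nonneg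
  have hB' : M = B.conjTranspose * B := hB
  let e := (WithLp.linearEquiv 2 ℝ (V → ℝ)).symm
  let W : Submodule ℝ (EuclideanSpace ℝ V) :=
    (Submodule.span ℝ (Set.range B.col)).map e.toLinearMap
  have hW : Module.finrank ℝ W ≤ d := by
    have h1 : Module.finrank ℝ W = Module.finrank ℝ (Submodule.span ℝ (Set.range B.col)) :=
      LinearEquiv.finrank_map_eq e _
    rw [h1, ← Matrix.rank_eq_finrank_span_cols, ← Matrix.rank_conjTranspose_mul_self, ← hB']
    exact hr
  let b := stdOrthonormalBasis ℝ W
  let f : W →ₗ[ℝ] EuclideanSpace ℝ (Fin d) :=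
    b.toBasis.constr ℝ fun a => EuclideanSpace.basisFun (Fin d) ℝ (Fin.castLE hW a)
  have hf : Orthonormal ℝ (f ∘ b.toBasis) := by
    have : f ∘ b.toBasis = fun a => EuclideanSpace.basisFun (Fin d) ℝ (Fin.castLE hW a) := by
      ext1 a
      simp only [f, Function.comp_apply, Module.Basis.constr_basis]
    rw [this]
    exact (EuclideanSpace.basisFun (Fin d) ℝ).orthonormal.comp _ (Fin.castLE_injective hW)
  let F := f.isometryOfOrthonormal (v := b.toBasis) (by simp) hf
  let c : V → W := fun i => ⟨e (B.col i), Submodule.mem_map_of_mem (Submodule.subset_span ⟨i, rfl⟩)⟩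
  refine ⟨fun i => F (c i), fun i j => ?_⟩
  rw [F.inner_map_map, hB', Matrix.mul_apply, Submodule.coe_inner]
  simp only [c, EuclideanSpace.inner_eq_star_dotProduct, dotProduct]
  refine Finset.sum_congr rfl fun k _ => ?_
  simp [e, mul_comm]

/-- A positive semidefinite `x - A + J / 2` of large nullity gives equiangular lines. -/
theorem card_mem_of_gramNonneg {α : ℝ} (hα : 0 < α) (hα1 : α < 1) {V : Type} [Fintype V]
    [DecidableEq V] {G : SimpleGraph V} (hM : GramNonneg G ((1 - α) / (2 * α)))
    (hd : Fintype.card V ≤ d + Module.finrank ℝ (gramKer G ((1 - α) / (2 * α)))) :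
    Fintype.card V ∈ equiangularSizes α d := by
  classical
  set lam := (1 - α) / (2 * α) with hlam
  have h2l : 2 * α * lam = 1 - α := by rw [hlam]; field_simp
  let M : Matrix V V ℝ := fun i j => α - 2 * α * adjM G i j + if i = j then 1 - α else 0
  have hmul : ∀ x j, M.mulVec x j =
      2 * α * (lam * x j - (adjM G).mulVec x j + (∑ i, x i) / 2) := by
    intro x j
    simp only [M, Matrix.mulVec, dotProduct, add_mul, sub_mul, Finset.sum_add_distrib,
      Finset.sum_sub_distrib, ite_mul, zero_mul, Finset.sum_ite_eq, Finset.mem_univ, if_true,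
      mul_assoc, ← Finset.mul_sum]
    linear_combination -(x j) * h2l
  have hherm : M.IsHermitian := by
    ext i j
    rw [Matrix.conjTranspose_apply, star_trivial]
    by_cases h : i = j
    · rw [h]
    · simp only [M, adjM_symm G j i, h, Ne.symm h, if_false]
  have hform : ∀ x, x ⬝ᵥ M.mulVec x =
      2 * α * (lam * (x ⬝ᵥ x) - x ⬝ᵥ (adjM G).mulVec x + (∑ i, x i) ^ 2 / 2) := by
    intro x
    have : M.mulVec x = (2 * α) • (lam • x - (adjM G).mulVec x + fun _ => (∑ i, x i) / 2) := by
      ext j; rw [hmul]; rfl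
    rw [this, dotProduct_smul, dotProduct_add, dotProduct_sub, dotProduct_smul, smul_eq_mul,
      smul_eq_mul]
    congr 2
    simp only [dotProduct, ← Finset.sum_mul]
    ring
  have hpsd : M.PosSemidef := by
    refine Matrix.PosSemidef.of_dotProduct_mulVec_nonneg hherm fun x => ?_
    rw [star_trivial, hform]
    exact mul_nonneg (by linarith) (hM x)
  have hrank : M.rank ≤ d := by
    have h1 := M.mulVecLin.finrank_range_add_finrank_ker
    rw [Module.finrank_fintype_fun_eq_card] at h1
    have h2 : gramKer G lam ≤ LinearMap.ker M.mulVecLin := by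
      intro x hx
      rw [LinearMap.mem_ker, Matrix.mulVecLin_apply]
      ext j
      rw [hmul, hx j, mul_zero]; rfl
    have h3 := Submodule.finrank_mono h2
    unfold Matrix.rank
    omega
  obtain ⟨w, hw⟩ := exists_gram_vectors hpsd hrank
  refine EquiVecs.card_mem hα hα1 (v := w) ⟨fun i => ?_, fun i j hij => ?_⟩
  · rw [hw]; simp [M, adjM]
  · rw [hw]
    by_cases h : G.Adj i j
    · right; simp only [M, adjM, h, hij, if_true, if_false]; ring
    · left; simp [M, adjM, h, hij]

/-- Every linear relation among the vectors lies in the kernel of the Gram matrix; apply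
rank–nullity. -/
theorem card_le_add_finrank {α : ℝ} (hα : 0 < α) {V : Type} [Fintype V] [DecidableEq V]
    {v : V → EuclideanSpace ℝ (Fin d)} (hv : EquiVecs α v) : Fintype.card V ≤
      d + Module.finrank ℝ (gramKer (negGraph v) ((1 - α) / (2 * α))) := by
  have h1 := (Fintype.linearCombination ℝ v).finrank_range_add_finrank_ker
  rw [Module.finrank_fintype_fun_eq_card] at h1
  have h2 := Submodule.finrank_le (LinearMap.range (Fintype.linearCombination ℝ v))
  rw [finrank_euclideanSpace_fin] at h2
  have h3 : LinearMap.ker (Fintype.linearCombination ℝ v) ≤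
      gramKer (negGraph v) ((1 - α) / (2 * α)) := by
    intro x hx j
    have hx' : ∑ i, x i • v i = 0 := by
      rw [LinearMap.mem_ker, Fintype.linearCombination_apply] at hx; exact hx
    have := hv.inner_sum hα x j
    rw [hx', inner_zero_right] at this
    have h2α : 2 * α ≠ 0 := by positivity
    exact (mul_eq_zero.1 this.symm).resolve_left h2α
  have := Submodule.finrank_mono h3
  omega

/-- If ν is an eigenvalue of λ - A, then λ - ν is one of A, so ν ≥ 0 and λ - A is positive
semidefinite. -/
theorem adjM_form_le_of_isTopEigenvalue {k : ℕ} {H : SimpleGraph (Fin k)} {lam : ℝ}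
    (hH : IsTopEigenvalue H lam) (y : Fin k → ℝ) :
    y ⬝ᵥ (adjM H).mulVec y ≤ lam * (y ⬝ᵥ y) := by
  classical
  have hadj : adjM H = H.adjMatrix ℝ := by ext i j; simp [adjM, SimpleGraph.adjMatrix_apply]
  have hherm : (lam • (1 : Matrix (Fin k) (Fin k) ℝ) - adjM H).IsHermitian := by
    ext i j
    simp [Matrix.one_apply, adjM_symm H j i, eq_comm]
  have hmul : ∀ x, (lam • (1 : Matrix (Fin k) (Fin k) ℝ) - adjM H).mulVec x =
      lam • x - (adjM H).mulVec x := by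
    intro x; rw [Matrix.sub_mulVec, Matrix.smul_mulVec, Matrix.one_mulVec]
  have hpsd : (lam • (1 : Matrix (Fin k) (Fin k) ℝ) - adjM H).PosSemidef := by
    rw [hherm.posSemidef_iff_eigenvalues_nonneg]
    intro i
    have he := hherm.mulVec_eigenvectorBasis i
    set x : Fin k → ℝ := ⇑(hherm.eigenvectorBasis i) with hx
    have hx0 : x ≠ 0 := by
      intro h0
      have h1 := hherm.eigenvectorBasis.orthonormal.1 i
      have h2 : hherm.eigenvectorBasis i = 0 := by ext j; exact congrFun h0 j
      rw [h2, norm_zero] at h1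
      norm_num at h1
    rw [hmul] at he
    have hev : lam - hherm.eigenvalues i ∈
        {μ : ℝ | Module.End.HasEigenvalue (Matrix.toLin' (H.adjMatrix ℝ)) μ} := by
      refine Module.End.hasEigenvalue_of_hasEigenvector (x := x) ⟨?_, hx0⟩
      rw [Module.End.mem_eigenspace_iff, Matrix.toLin'_apply, ← hadj, sub_smul, ← he]
      abel
    have hle : lam - hherm.eigenvalues i ≤ lam := hH.2 (by convert hev)
    change 0 ≤ hherm.eigenvalues i
    linarith
  have h := hpsd.dotProduct_mulVec_nonneg y
  rw [hmul, star_trivial, dotProduct_sub, dotProduct_smul, smul_eq_mul] at h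
  linarith

theorem exists_eigenvector_of_isTopEigenvalue {k : ℕ} {H : SimpleGraph (Fin k)} {lam : ℝ}
    (hH : IsTopEigenvalue H lam) : ∃ x : Fin k → ℝ, x ≠ 0 ∧ (adjM H).mulVec x = lam • x := by
  classical
  have h1 : Module.End.HasEigenvalue (Matrix.toLin' (H.adjMatrix ℝ)) lam := by
    convert hH.1
  obtain ⟨x, hx⟩ := h1.exists_hasEigenvector
  refine ⟨x, hx.2, ?_⟩
  have hadj : adjM H = H.adjMatrix ℝ := by ext i j; simp [adjM, SimpleGraph.adjMatrix_apply]
  rw [hadj, ← Matrix.toLin'_apply]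
  exact Module.End.mem_eigenspace_iff.1 hx.1

/-- `q` disjoint copies of `H` and `r` isolated vertices. -/
def copiesGraph {k : ℕ} (H : SimpleGraph (Fin k)) (q r : ℕ) :
    SimpleGraph ((Fin q × Fin k) ⊕ Fin r) where
  Adj
    | .inl a, .inl b => a.1 = b.1 ∧ H.Adj a.2 b.2
    | _, _ => False
  symm := ⟨by
    rintro (a | a) (b | b) h
    · exact ⟨h.1.symm, h.2.symm⟩
    all_goals exact h⟩
  loopless := ⟨by
    rintro (a | a) h
    · exact H.irrefl h.2
    · exact h⟩

theorem copiesGraph_mulVec_inl {k : ℕ} (H : SimpleGraph (Fin k)) (q r : ℕ)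
    (x : (Fin q × Fin k) ⊕ Fin r → ℝ) (a : Fin q) (i : Fin k) :
    (adjM (copiesGraph H q r)).mulVec x (.inl (a, i)) =
      (adjM H).mulVec (fun j => x (.inl (a, j))) i := by
  classical
  simp only [Matrix.mulVec, dotProduct, Fintype.sum_sum_type, Fintype.sum_prod_type]
  rw [Finset.sum_eq_single a]
  · simp [adjM, copiesGraph]
  · intro b _ hb
    exact Finset.sum_eq_zero fun j _ => by simp [adjM, copiesGraph, hb.symm]
  · simp

theorem copiesGraph_mulVec_inr {k : ℕ} (H : SimpleGraph (Fin k)) (q r : ℕ)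
    (x : (Fin q × Fin k) ⊕ Fin r → ℝ) (b : Fin r) :
    (adjM (copiesGraph H q r)).mulVec x (.inr b) = 0 := by
  classical
  simp only [Matrix.mulVec, dotProduct]
  exact Finset.sum_eq_zero fun j _ => by simp [adjM, copiesGraph]

theorem copiesGraph_gramNonneg {k : ℕ} {H : SimpleGraph (Fin k)} {lam : ℝ} (hlam : 0 ≤ lam)
    (hH : IsTopEigenvalue H lam) (q r : ℕ) : GramNonneg (copiesGraph H q r) lam := by
  intro x
  have h : x ⬝ᵥ (adjM (copiesGraph H q r)).mulVec x ≤ lam * (x ⬝ᵥ x) := by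
    simp only [dotProduct, Fintype.sum_sum_type, Fintype.sum_prod_type, copiesGraph_mulVec_inl,
      copiesGraph_mulVec_inr, mul_zero, Finset.sum_const_zero, add_zero, mul_add]
    have h1 : 0 ≤ lam * ∑ b, x (.inr b) * x (.inr b) :=
      mul_nonneg hlam (Finset.sum_nonneg fun b _ => mul_self_nonneg _)
    refine le_trans ?_ (le_add_of_nonneg_right h1)
    rw [Finset.mul_sum]
    exact Finset.sum_le_sum fun a _ =>
      adjM_form_le_of_isTopEigenvalue hH fun j => x (.inl (a, j))
  have := sq_nonneg (∑ i, x i)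
  linarith

/-- Scaling an eigenvector of `H` independently on each copy gives `q` dimensions; the sum-zero
condition, under which J drops out, costs one. -/
theorem le_finrank_copiesGraph {k : ℕ} {H : SimpleGraph (Fin k)} {lam : ℝ}
    (hH : IsTopEigenvalue H lam) (q r : ℕ) :
    q ≤ 1 + Module.finrank ℝ (gramKer (copiesGraph H q r) lam) := by
  obtain ⟨x, hx0, hx⟩ := exists_eigenvector_of_isTopEigenvalue hH
  let f : (Fin q → ℝ) →ₗ[ℝ] ((Fin q × Fin k) ⊕ Fin r → ℝ) :=
    { toFun := fun c => Sum.elim (fun p => c p.1 * x p.2) fun _ => 0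
      map_add' := fun c c' => by ext (p | p) <;> simp [add_mul]
      map_smul' := fun t c => by ext (p | p) <;> simp [mul_assoc] }
  have hf : Function.Injective f := by
    intro c c' h
    obtain ⟨i, hi⟩ := Function.ne_iff.1 hx0
    ext a
    have : c a * x i = c' a * x i := congrFun h (.inl (a, i))
    exact mul_right_cancel₀ hi this
  have hrange := LinearMap.finrank_range_of_inj hf
  rw [Module.finrank_fintype_fun_eq_card, Fintype.card_fin] at hrange
  have h1 := finrank_le_add_inf_ker (LinearMap.range f) (sumMap ((Fin q × Fin k) ⊕ Fin r))
  rw [Module.finrank_self, hrange] at h1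
  refine h1.trans (Nat.add_le_add_left (Submodule.finrank_mono ?_) 1)
  rintro _ ⟨⟨c, rfl⟩, hs⟩ j
  have hs' : ∑ i, f c i = 0 := hs
  rw [hs']
  rcases j with ⟨a, i⟩ | b
  · rw [copiesGraph_mulVec_inl]
    have h2 : (fun j => f c (.inl (a, j))) = c a • x := by ext j; rfl
    rw [h2, Matrix.mulVec_smul, hx]
    change lam * (c a * x i) - c a * (lam * x i) + 0 / 2 = 0
    ring
  · rw [copiesGraph_mulVec_inr]
    change lam * 0 - 0 + 0 / 2 = 0
    ring

end Lines

/-! ### The spectral radius order -/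

theorem two_le_of_isTopEigenvalue {k : ℕ} {H : SimpleGraph (Fin k)} {lam : ℝ} (hlam : 0 < lam)
    (hH : IsTopEigenvalue H lam) : 2 ≤ k := by
  by_contra hk
  obtain ⟨x, hx0, hx⟩ := exists_eigenvector_of_isTopEigenvalue hH
  have : Subsingleton (Fin k) := Fin.subsingleton_iff_le_one.2 (by omega)
  refine hx0 (funext fun i => ?_)
  have h1 := congrFun hx i
  have h2 : (adjM H).mulVec x i = 0 := by
    rw [Matrix.mulVec, dotProduct]
    refine Finset.sum_eq_zero fun j _ => ?_
    rw [Subsingleton.elim j i]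
    simp [adjM]
  rw [h2, Pi.smul_apply, smul_eq_mul] at h1
  exact (mul_eq_zero.1 h1.symm).resolve_left hlam.ne'

theorem two_le_spectralRadiusOrder {lam : ℝ} (hlam : 0 < lam) :
    ((2 : ℕ) : ℕ∞) ≤ spectralRadiusOrder lam := by
  refine le_sInf ?_
  rintro _ ⟨n, rfl, H, hH⟩
  exact Nat.cast_le.2 (two_le_of_isTopEigenvalue hlam hH)

theorem exists_isTopEigenvalue_of_order_eq {lam : ℝ} {k : ℕ}
    (h : spectralRadiusOrder lam = (k : ℕ∞)) : ∃ H : SimpleGraph (Fin k), IsTopEigenvalue H lam := by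
  have hne : {k : ℕ∞ | ∃ n : ℕ, k = (n : ℕ∞) ∧
      ∃ G : SimpleGraph (Fin n), IsTopEigenvalue G lam}.Nonempty := by
    by_contra hempty
    rw [Set.not_nonempty_iff_eq_empty] at hempty
    rw [spectralRadiusOrder, hempty, sInf_empty] at h
    exact ENat.top_ne_natCast k h
  obtain ⟨n, hn, H, hH⟩ := csInf_mem hne
  have : k = n := by
    have h' : (k : ℕ∞) = n := h.symm.trans hn
    exact_mod_cast h'
  subst this
  exact ⟨H, hH⟩

/-! ### Upper and lower bounds for the number of lines -/

section Bounds

variable {α : ℝ} (hα : 0 < α) (hα1 : α < 1)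

include hα hα1

theorem lam_pos : 0 < (1 - α) / (2 * α) := div_pos (by linarith) (by linarith)

/-- The outcomes reflect the nullity: sublinear because a component exceeds λ, zero, or at most m -
1 because `m` components have top eigenvalue exactly λ. -/
theorem exists_size_bound (ε : ℝ) (hε : 0 < ε) : ∃ C : ℝ, 0 ≤ C ∧ ∀ d n : ℕ,
    n ∈ equiangularSizes α d → (n : ℝ) ≤ d + ε * n + C ∨ n ≤ d ∨
      ∃ m : ℕ, 1 ≤ m ∧ n + 1 ≤ d + m ∧
        ∀ k : ℕ, (k : ℕ∞) ≤ spectralRadiusOrder ((1 - α) / (2 * α)) → m * k ≤ n := by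
  obtain ⟨D, hD⟩ := exists_bounded_degree_switching α hα hα1
  obtain ⟨C, hC⟩ := exists_finrank_gramKer_le _ (lam_pos hα hα1) D ε hε
  refine ⟨max C 0, le_max_right _ _, fun d n hn => ?_⟩
  obtain ⟨v, hv⟩ := exists_equiVecs hα hα1 hn
  obtain ⟨w, hw, hdeg⟩ := hD d (Fin n) v hv
  have hcard := card_le_add_finrank hα hw
  rw [Fintype.card_fin] at hcard
  rcases hC (Fin n) (negGraph w) (hw.gramNonneg hα) hdeg with h | h | ⟨m, hm, hk⟩
  · left
    rw [Fintype.card_fin] at h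
    have h1 : (n : ℝ) ≤ d + Module.finrank ℝ (gramKer (negGraph w) ((1 - α) / (2 * α))) := by
      exact_mod_cast hcard
    have := le_max_left C 0
    linarith
  · right; left; omega
  · right; right
    rw [Fintype.card_fin] at hk
    exact ⟨m, by omega, by omega, hk⟩

/-- Needed because `sSup` of an unbounded set of naturals is 0 by convention. The order is always at
least 2, which gives n ≤ 2d in the last case. -/
theorem bddAbove_equiangularSizes (d : ℕ) : BddAbove (equiangularSizes α d) := by
  obtain ⟨C, hC0, hC⟩ := exists_size_bound hα hα1 (1 / 2) (by norm_num)
  refine ⟨⌈2 * d + 2 * C⌉₊, fun n hn => ?_⟩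
  have key : (n : ℝ) ≤ 2 * d + 2 * C := by
    rcases hC d n hn with h | h | ⟨m, -, h1, h2⟩
    · linarith
    · have : (n : ℝ) ≤ d := by exact_mod_cast h
      have : (0 : ℝ) ≤ d := by positivity
      linarith
    · have := h2 2 (two_le_spectralRadiusOrder (lam_pos hα hα1))
      have : (n : ℝ) ≤ 2 * d := by exact_mod_cast (show n ≤ 2 * d by omega)
      linarith
  exact_mod_cast key.trans (Nat.le_ceil _)

theorem isGreatest_maxEquiangularLines (d : ℕ) :
    IsGreatest (equiangularSizes α d) (maxEquiangularLines α d) := by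
  have hb := bddAbove_equiangularSizes hα hα1 d
  exact ⟨Nat.sSup_mem ⟨0, ∅, by simp⟩ hb, fun n hn => le_csSup hb hn⟩

/-- The edgeless graph on `d` vertices qualifies. -/
theorem le_maxEquiangularLines (d : ℕ) : d ≤ maxEquiangularLines α d := by
  refine (isGreatest_maxEquiangularLines hα hα1 d).2 ?_
  have h := card_mem_of_gramNonneg (d := d) hα hα1 (G := (⊥ : SimpleGraph (Fin d))) ?_ (by simp)
  · rwa [Fintype.card_fin] at h
  · intro x
    have h0 : (adjM (⊥ : SimpleGraph (Fin d))).mulVec x = 0 := by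
      ext i
      rw [Matrix.mulVec, dotProduct]
      exact Finset.sum_eq_zero fun j _ => by simp [adjM]
    rw [h0, dotProduct_zero, sub_zero]
    have := mul_nonneg (lam_pos hα hα1).le (dot_self_nonneg x)
    positivity

theorem copies_le_maxEquiangularLines {k : ℕ} {H : SimpleGraph (Fin k)}
    (hH : IsTopEigenvalue H ((1 - α) / (2 * α))) {q r d : ℕ} (hd : q * k + r + 1 ≤ d + q) :
    q * k + r ≤ maxEquiangularLines α d := by
  refine (isGreatest_maxEquiangularLines hα hα1 d).2 ?_
  have hc : Fintype.card ((Fin q × Fin k) ⊕ Fin r) = q * k + r := by simp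
  have h1 := le_finrank_copiesGraph hH q r
  have h := card_mem_of_gramNonneg (d := d) hα hα1
    (copiesGraph_gramNonneg (lam_pos hα hα1).le hH q r) (by rw [hc]; omega)
  rwa [hc] at h

theorem maxEquiangularLines_eq_floor {k : ℕ}
    (hk : spectralRadiusOrder ((1 - α) / (2 * α)) = (k : ℕ∞)) : ∃ d₀ : ℕ, ∀ d : ℕ, d₀ ≤ d →
      (maxEquiangularLines α d : ℤ) = ⌊(k : ℝ) / ((k : ℝ) - 1) * ((d : ℝ) - 1)⌋ := by
  obtain ⟨H, hH⟩ := exists_isTopEigenvalue_of_order_eq hk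
  have hk2 : 2 ≤ k := two_le_of_isTopEigenvalue (lam_pos hα hα1) hH
  have hk2' : (2 : ℝ) ≤ k := by exact_mod_cast hk2
  obtain ⟨C, hC0, hC⟩ := exists_size_bound hα hα1 (1 / (2 * k)) (by positivity)
  -- The first entry settles the case N ≤ d. The second makes 2k(d + C)/(2k - 1), the bound for ε =
  -- 1/(2k), at most k(d - 1)/(k - 1).
  refine ⟨max (k + 1) (⌈2 * (k - 1) * C⌉₊ + 2 * k), fun d hd => ?_⟩
  have hd1 : k + 1 ≤ d := (le_max_left _ _).trans hd
  have hd2 : 2 * ((k : ℝ) - 1) * C + 2 * k ≤ d := by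
    have h1 : ((⌈2 * ((k : ℝ) - 1) * C⌉₊ + 2 * k : ℕ) : ℝ) ≤ d := by
      exact_mod_cast (le_max_right _ _).trans hd
    push_cast at h1
    have := Nat.le_ceil (2 * ((k : ℝ) - 1) * C)
    linarith
  set N := maxEquiangularLines α d with hN
  have hk1 : (0 : ℝ) < k - 1 := by linarith
  have hdk : (k : ℝ) + 1 ≤ d := by exact_mod_cast hd1
  have hupper : ((k : ℝ) - 1) * N ≤ k * (d - 1) := by
    rcases hC d N (isGreatest_maxEquiangularLines hα hα1 d).1 with h | h | ⟨m, -, h1, h2⟩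
    · have h1 : (2 * k : ℝ) * N ≤ 2 * k * d + N + 2 * k * C := by
        have := mul_le_mul_of_nonneg_left h (by positivity : (0 : ℝ) ≤ 2 * k)
        have e : (2 * k : ℝ) * (d + 1 / (2 * k) * N + C) = 2 * k * d + N + 2 * k * C := by
          field_simp
        linarith
      have h2 : ((k : ℝ) - 1) * ((2 * k - 1) * N) ≤ (k - 1) * (2 * k * (d + C)) :=
        mul_le_mul_of_nonneg_left (by linarith) hk1.le
      have h3 : 2 * ((k : ℝ) - 1) * (d + C) ≤ (2 * k - 1) * (d - 1) := by linarith
      have h4 := mul_le_mul_of_nonneg_left h3 (by positivity : (0 : ℝ) ≤ k)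
      have h5 : (2 * (k : ℝ) - 1) * ((k - 1) * N) ≤ (2 * k - 1) * (k * (d - 1)) := by linarith
      exact le_of_mul_le_mul_left h5 (by linarith)
    · have h' : (N : ℝ) ≤ d := by exact_mod_cast h
      have := mul_le_mul_of_nonneg_left h' hk1.le
      linarith
    · have h2' : (m : ℝ) * k ≤ N := by exact_mod_cast h2 k hk.ge
      have h1' : (N : ℝ) + 1 ≤ d + m := by exact_mod_cast h1
      have := mul_le_mul_of_nonneg_left h1' (by positivity : (0 : ℝ) ≤ k)
      linarith
  obtain ⟨p, rfl⟩ : ∃ p, k = p + 1 := ⟨k - 1, by omega⟩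
  have hp : 0 < p := by omega
  -- With d - 1 = q(k - 1) + r, taking `q` copies of `H` and `r` isolated vertices gives qk + r
  -- lines, which is the floor because r < k - 1.
  set q := (d - 1) / p with hq
  set r := (d - 1) % p with hr
  have hqr : p * q + r = d - 1 := Nat.div_add_mod (d - 1) p
  have hrp : r < p := Nat.mod_lt _ hp
  have hlower : q * (p + 1) + r ≤ N := copies_le_maxEquiangularLines hα hα1 hH
    (by have : q * (p + 1) = p * q + q := by ring
        omega)
  have hqr' : (p : ℝ) * q + r = d - 1 := by
    have : p * q + r + 1 = d := by omega
    rw [← this]; push_cast; ring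
  have hlower' : (q : ℝ) * (p + 1) + r ≤ N := by exact_mod_cast hlower
  have hrp' : (r : ℝ) < p := by exact_mod_cast hrp
  have hp' : (0 : ℝ) < p := by exact_mod_cast hp
  symm
  rw [Int.floor_eq_iff]
  push_cast at hupper ⊢
  rw [add_sub_cancel_right] at hupper ⊢
  rw [div_mul_eq_mul_div]
  constructor
  · rw [le_div_iff₀ hp']; linarith
  · rw [div_lt_iff₀ hp', ← hqr']
    have := mul_le_mul_of_nonneg_right hlower' hp'.le
    linarith

theorem maxEquiangularLines_isLittleO (hk : spectralRadiusOrder ((1 - α) / (2 * α)) = ⊤) :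
    Asymptotics.IsLittleO Filter.atTop
      (fun d : ℕ => (maxEquiangularLines α d : ℝ) - (d : ℝ)) (fun d : ℕ => (d : ℝ)) := by
  rw [Asymptotics.isLittleO_iff]
  intro c hc
  -- The bound 1/2 gives N ≤ 2d + 2C; inserting this in εN, the bound c/4 gives N - d ≤ cd/2 + 2C,
  -- which is at most cd once d ≥ 4C/c.
  set ε := min (1 / 2) (c / 4) with hε
  have hε0 : 0 < ε := lt_min (by norm_num) (by linarith)
  have hε1 : ε ≤ 1 / 2 := min_le_left _ _
  have hε2 : ε ≤ c / 4 := min_le_right _ _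
  obtain ⟨C, hC0, hC⟩ := exists_size_bound hα hα1 ε hε0
  filter_upwards [Filter.eventually_ge_atTop ⌈4 * C / c⌉₊] with d hd
  have hd' : 4 * C / c ≤ d := (Nat.le_ceil _).trans (by exact_mod_cast hd)
  rw [div_le_iff₀ hc] at hd'
  have hd0 : (0 : ℝ) ≤ d := by positivity
  have hlow : (d : ℝ) ≤ maxEquiangularLines α d := by
    exact_mod_cast le_maxEquiangularLines hα hα1 d
  rw [Real.norm_of_nonneg (by linarith), Real.norm_of_nonneg hd0]
  rcases hC d _ (isGreatest_maxEquiangularLines hα hα1 d).1 with h | h | ⟨m, hm, -, h2⟩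
  · set N : ℝ := (maxEquiangularLines α d : ℝ)
    have hN0 : 0 ≤ N := hd0.trans hlow
    have h1 : ε * N ≤ 1 / 2 * N := mul_le_mul_of_nonneg_right hε1 hN0
    have h3 : N ≤ 2 * d + 2 * C := by linarith
    have h4 : ε * N ≤ ε * (2 * d + 2 * C) := mul_le_mul_of_nonneg_left h3 hε0.le
    have h5 : ε * d ≤ c / 4 * d := mul_le_mul_of_nonneg_right hε2 hd0
    have h6 : ε * C ≤ 1 / 2 * C := mul_le_mul_of_nonneg_right hε1 hC0
    linarith
  · have : (maxEquiangularLines α d : ℝ) ≤ d := by exact_mod_cast h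
    have := mul_nonneg hc.le hd0
    linarith
  -- With infinite order any `k` is allowed; k = N + 1 and m ≥ 1 would give N + 1 ≤ N.
  · have := h2 (maxEquiangularLines α d + 1) (by rw [hk]; exact le_top)
    have := Nat.mul_le_mul_right (maxEquiangularLines α d + 1) hm
    omega

end Bounds

theorem theorem3 (α : ℝ) (hα0 : 0 < α) (hα1 : α < 1) :
    (∀ d : ℕ, IsGreatest (equiangularSizes α d) (maxEquiangularLines α d)) ∧
    (∀ k : ℕ, spectralRadiusOrder ((1 - α) / (2 * α)) = (k : ℕ∞) →
      ∃ d₀ : ℕ, ∀ d : ℕ, d₀ ≤ d →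
        (maxEquiangularLines α d : ℤ) = ⌊(k : ℝ) / ((k : ℝ) - 1) * ((d : ℝ) - 1)⌋) ∧
    (spectralRadiusOrder ((1 - α) / (2 * α)) = ⊤ →
      Asymptotics.IsLittleO Filter.atTop
        (fun d : ℕ => (maxEquiangularLines α d : ℝ) - (d : ℝ)) (fun d : ℕ => (d : ℝ))) := by
  exact ⟨isGreatest_maxEquiangularLines hα0 hα1,
    fun _ hk => maxEquiangularLines_eq_floor hα0 hα1 hk,
    maxEquiangularLines_isLittleO hα0 hα1⟩
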